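/- Let $W\subseteq\mathbb R^d$ be a closed convex hypothesis space with Euclidean projection $\Pi_W$ (the identity if $W=\mathbb R^d$). There are $n$ samples with losses $f_1,\dots,f_n$, and $M\ge1$ nodes with $n/M\in\mathbb N$ samples each; the samples are assigned to the nodes uniformly at random, and each node draws its samples in a random order without replacement, in mini-batches of size $b\ge 1$. Suppose that every $f_i$ is differentiable at the points of $W$, $\gamma$-strongly convex on $W$ (i.e. $f_i(u)\ge f_i(v)+\langle\nabla f_i(v),u-v\rangle+\frac\gamma2\|u-v\|^2$ for $u,v\in W$, where $\gamma>0$) and $L$-Lipschitz on $W$, and that $\|\nabla f_i(w)\|^2\le B^2$ for all $i$ and all $w\in W$, where $B>0$. Let $F=\frac1n\sum_i f_i$ and $w^*\in\arg\min_{w\in W}F(w)$. Let $\varepsilon>0$ and $0<\delta<1$. The deep-Q controlled algorithm keeps a local model $w^{L_m}$ for each node $m$ and one global model $w^G$, initialized in $W$ at $w_1^{L_m}$, $w_1^G$. At each step $t=1,\dots,T$, where $1\le T\le \frac{n}{bM}$, every node updates exactly once, one node after the other in a given order. When its turn comes, node $m$ takes its next mini-batch $D_m(t)$ and writes $\nabla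 f_{D_m(t)}=\frac1b\sum_{i\in D_m(t)}\nabla f_i$. With probability $p_{t,L}^{L_m}$ it replaces its local model by $\Pi_W\big(w^{L_m}-2\eta_t\nabla f_{D_m(t)}(w^{L_m})\big)$; with probability $p_{t,G}^{L_m}=1-p_{t,L}^{L_m}$ it replaces both the global model (as left by the previous update) and its local model by $\Pi_W\big(\frac{w^G+w^{L_m}}2-\eta_t(\nabla f_{D_m(t)}(w^G)+N_t^m)\big)$. Here $\eta_tN_t^m$ is fresh Gaussian noise on $\mathbb R^d$, centered, with covariance $\sigma^2 I_d$, where $\sigma=\sqrt{2\ln(1.25/\delta)}\,\Delta/\varepsilon$ and $\Delta=\max_{r\le k\le t}\frac{2\eta_kL}{b}$, and $r-1$ is the last step before $t$ at which node $m$ updated the global model ($r=1$ if there is none). The probabilities are computed by the controller (e.g. a deep-Q learner with random exploration, with internal randomness independent of everything else) from the information available when the node chooses: everything that happened in earlier updates, and the current mini-batch. They are conditional probabilities given this information. Let $a>0$ be such that $p_{t,L}^{L_m}\ge a$ and $p_{t,G}^{L_m}\ge a$ for all $m$ and all $1\le t\le T$ (in particular, $a$ may be their minimum), and let the step size be $\eta_t=\frac1{a\gamma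 t}$ for all nodes. Then there is a constant $C$ depending only on $\gamma$ such that for all $1\le t\le T$ all the expectations below are finite and $$\sum_{m=1}^M\mathbb E\big[\|w_{t+1}^{L_m}-w^*\|^2\big]+\mathbb E\big[\|w_{t+1}^{G}-w^*\|^2\big]\le C\left(\frac{MB^2}{a^2t}+\frac{MB^2\log t}{a^2bt}+\frac{d\,ML^2\ln(1.25/\delta)}{a^2b^2\varepsilon^2t}\right).$$ -/

import Mathlib

open MeasureTheory ProbabilityTheory

noncomputable section

namespace DeepQSGD

/-- The parameter space `ℝ^d` with the standard inner product and the 2-norm. -/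
abbrev Vec (d : ℕ) : Type := EuclideanSpace ℝ (Fin d)

/-- `f` is differentiable at the points of the hypothesis space `W` and
`f u ≥ f v + ⟨∇f v, u - v⟩ + (γ/2)‖u - v‖²` for all `u, v ∈ W`. -/
def StronglyConvex {d : ℕ} (W : Set (Vec d)) (γ : ℝ) (f : Vec d → ℝ) : Prop :=
  (∀ v ∈ W, DifferentiableAt ℝ f v) ∧
    ∀ u ∈ W, ∀ v ∈ W,
      f v + inner ℝ (gradient f v) (u - v) + γ / 2 * ‖u - v‖ ^ 2 ≤ f u

/-- `f` is `L`-Lipschitz on the hypothesis space `W`. -/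
def Lipschitz {d : ℕ} (W : Set (Vec d)) (L : ℝ) (f : Vec d → ℝ) : Prop :=
  ∀ u ∈ W, ∀ v ∈ W, |f u - f v| ≤ L * ‖u - v‖

/-- The empirical risk `F(w) = (1/n) ∑ f_i(w)`. -/
def empiricalRisk {d n : ℕ} (f : Fin n → Vec d → ℝ) (w : Vec d) : ℝ :=
  (1 / (n : ℝ)) * ∑ i, f i w

open Classical in
/-- The Euclidean projection onto `W`: the point of `W` nearest to `x`. It exists and is unique
when `W` is nonempty, closed and convex, and it is the identity when `W` is the whole space. -/
def proj {d : ℕ} (W : Set (Vec d)) (x : Vec d) : Vec d :=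
  if h : ∃ y ∈ W, ∀ z ∈ W, ‖x - y‖ ≤ ‖x - z‖ then h.choose else x

/-- Everything that is fixed before a run: the losses `f i = f(·, (x_i, y_i))` on the `n` samples,
the hypothesis space, the initial local models and the initial global model, the mini-batch
size, the strong convexity and Lipschitz parameters, the constant `a` of the step size, the
privacy parameters, and the order in which the nodes act within each step. -/
structure Setup (d n M : ℕ) where
  f : Fin n → Vec d → ℝ
  W : Set (Vec d)
  initLocal : Fin M → Vec d
  initGlobal : Vec d
  b : ℕ
  γ : ℝ
  L : ℝ
  a : ℝ
  ε : ℝ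
  δ : ℝ
  order : ℕ → Equiv.Perm (Fin M)

/-- An assignment of the `n` samples to the nodes: `α (m, k)` is the index of the `k`-th sample
drawn by node `m`, `k < n / M`. So `α` determines the `n / M` samples that make up the local
dataset of node `m` and the order in which node `m` draws them without replacement. -/
abbrev Assignment (n M : ℕ) : Type := Fin M × Fin (n / M) ≃ Fin n

instance (n M : ℕ) : MeasurableSpace (Assignment n M) := ⊤

/-- The randomness of a run. `seed` is the internal randomness of the deep-Q learners (weights at
initialization, sampling from the replay memories, ...); `coin (t, m)` decides the action of node
`m` at step `t`, once its probabilities have been computed; `gauss (t, m)` is the (normalized)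
Gaussian noise available to node `m` at step `t`. The components are
`(seed, assignment, fun (t, m) => (coin, gauss))`. -/
abbrev Sample (d n M : ℕ) (Ξ : Type) : Type :=
  Ξ × Assignment n M × (ℕ × Fin M → ℝ × Vec d)

namespace Sample

variable {d n M : ℕ} {Ξ : Type}

def seed (ω : Sample d n M Ξ) : Ξ := ω.1

def assign (ω : Sample d n M Ξ) : Assignment n M := ω.2.1

def coin (ω : Sample d n M Ξ) (t : ℕ) (m : Fin M) : ℝ := (ω.2.2 (t, m)).1

def gauss (ω : Sample d n M Ξ) (t : ℕ) (m : Fin M) : Vec d := (ω.2.2 (t, m)).2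

end Sample

/-- The joint law of the randomness: seed, assignment, coins and Gaussian vectors are independent,
the seed has law `ν`, the assignment is uniformly distributed, every coin is uniform on `[0, 1]`
and every Gaussian vector is standard normal on `ℝ^d`. -/
def law (d n M : ℕ) {Ξ : Type} [MeasurableSpace Ξ] (ν : Measure Ξ) :
    Measure (Sample d n M Ξ) :=
  ν.prod ((uniformOn (Set.univ : Set (Assignment n M))).prod
    (Measure.infinitePi fun _ : ℕ × Fin M =>
      ((volume : Measure ℝ).restrict (Set.Icc 0 1)).prod (stdGaussian (Vec d))))

namespace Setup

variable {d n M : ℕ} (S : Setup d n M)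

/-- The step size `η_t = 1 / (a γ t)`, `t ≥ 1`, the same for all nodes. -/
def stepSize (t : ℕ) : ℝ := 1 / (S.a * S.γ * t)

/-- The positions (in the order of drawing) of the mini-batch of step `t ≥ 1`: they are
`(t - 1) b, ..., t b - 1`. -/
def batch (t : ℕ) : Finset (Fin (n / M)) :=
  Finset.univ.filter fun k => k.val / S.b + 1 = t

/-- The mini-batch gradient `∇ f_{D_m(t)}(w) = (1/b) ∑_{i ∈ D_m(t)} ∇ f_i(w)`. -/
def batchGrad (α : Assignment n M) (t : ℕ) (m : Fin M) (w : Vec d) : Vec d :=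
  (1 / (S.b : ℝ)) • ∑ k ∈ S.batch t, gradient (S.f (α (m, k))) w

/-- `S.Before s m' t m`: the update of node `m'` at step `s` takes place before the update of
node `m` at step `t`. -/
def Before (s : ℕ) (m' : Fin M) (t : ℕ) (m : Fin M) : Prop :=
  s < t ∨ (s = t ∧ (S.order t).symm m' < (S.order t).symm m)

/-- `ω` and `ω'` agree on everything that has been realized when node `m` chooses its action at
step `t`: the seeds of the learners, the mini-batches, coins and noises of all earlier updates
(of all nodes), and the current mini-batch of node `m`. All earlier and current models, losses,
actions, rewards, replay memories and network weights are functions of these. -/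
def SameInfo {Ξ : Type} (t : ℕ) (m : Fin M) (ω ω' : Sample d n M Ξ) : Prop :=
  ω.seed = ω'.seed ∧
    (∀ s m', 1 ≤ s → S.Before s m' t m →
      (∀ k ∈ S.batch s, ω.assign (m', k) = ω'.assign (m', k)) ∧
        ω.coin s m' = ω'.coin s m' ∧ ω.gauss s m' = ω'.gauss s m') ∧
    ∀ k ∈ S.batch t, ω.assign (m, k) = ω'.assign (m, k)

/-- A controller: `p t m` is the probability `p_{t,L}^{L_m}` with which node `m` updates its local
model at step `t`, given the information available at that moment; the probability
`p_{t,G}^{L_m}` of updating the global model is `1 - p t m`. A deep-Q learner that explores at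
random with probability `q` is the case where `p t m` is `1 - q/2` or `q/2`, according to which
of the two actions has the larger Q-value under the network weights it has computed so far. -/
def IsController {Ξ : Type} [MeasurableSpace Ξ]
    (p : ℕ → Fin M → Sample d n M Ξ → ℝ) : Prop :=
  ∀ t m, Measurable (p t m) ∧ ∀ ω ω', S.SameInfo t m ω ω' → p t m ω = p t m ω'

/-- The models during a run, with the number `last m` of the last step at which node `m` updated
the global model (`0` if it has not done so yet). -/
structure State (d M : ℕ) where
  loc : Fin M → Vec d
  glob : Vec d
  last : Fin M → ℕ

/-- The sensitivity `max_{k ∈ [r, t]} 2 η_k L / b` of an update of the global model at step `t`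
by a node that has last done such an update at step `r - 1`. -/
def sensitivity (r t : ℕ) : ℝ :=
  ⨆ k : Finset.Icc r t, 2 * S.stepSize k.val * S.L / S.b

/-- The standard deviation (per coordinate) of `η_t N_t`, the smallest one that the Gaussian
mechanism prescribes for `(ε, δ)`-differential privacy: `c Δ / ε` with `c² = 2 ln(1.25 / δ)`. -/
def noiseStd (r t : ℕ) : ℝ :=
  Real.sqrt (2 * Real.log (1.25 / S.δ)) * S.sensitivity r t / S.ε

/-- Node `m` updates at step `t`: its local model if its coin falls below `p t m`, and otherwise
the global model (as left by the previous update), which then also becomes its local model. The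
new model is projected onto the hypothesis space. -/
def nodeUpdate {Ξ : Type} (p : ℕ → Fin M → Sample d n M Ξ → ℝ) (ω : Sample d n M Ξ) (t : ℕ)
    (x : State d M) (m : Fin M) : State d M :=
  if ω.coin t m < p t m ω then
    { loc := Function.update x.loc m
        (proj S.W (x.loc m - (2 * S.stepSize t) • S.batchGrad ω.assign t m (x.loc m)))
      glob := x.glob
      last := x.last }
  else
    let N : Vec d := (S.noiseStd (x.last m + 1) t / S.stepSize t) • ω.gauss t m
    let w : Vec d := proj S.W ((1 / 2 : ℝ) • (x.glob + x.loc m) -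
      S.stepSize t • (S.batchGrad ω.assign t m x.glob + N))
    { loc := Function.update x.loc m w
      glob := w
      last := Function.update x.last m t }

/-- The state after `t` steps, so that `(run p ω t).loc m` is `w_{t+1}^{L_m}`, `(run p ω t).glob` is
`w_{t+1}^G`, and the models before the first step are the initial ones. In every step each node updates exactly once, one after the other,
in the order `order t 0, order t 1, ...`. -/
def run {Ξ : Type} (p : ℕ → Fin M → Sample d n M Ξ → ℝ) (ω : Sample d n M Ξ) : ℕ → State d M
  | 0 => { loc := S.initLocal, glob := S.initGlobal, last := fun _ => 0 }
  | t + 1 => ((List.finRange M).map (S.order (t + 1))).foldl (S.nodeUpdate p ω (t + 1))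
      (run p ω t)

end Setup

end DeepQSGD

end

/-! Progress is measured by the sum of the squared distances of all local models and of the global
model to `wStar`. Let x and y be the offsets from `wStar` of the acting node's local model and of
the global model, and let g be the mini-batch gradient at `wStar`. The probability of the local
action may depend on the current mini-batch, so a linear term weighted by it could not be averaged
over the sampling. The step 2η of the local branch prevents this: both branches produce the same
term -4η⟨g, x⟩, and the weights add up to 1. In the averaging branch the parallelogram law leaves
-‖x - y‖²/2, which pays for exchanging y for x in that term. Strong convexity contracts x in one
branch and y in the other. As each branch has probability at least a, the step size 1/(aγt) turns
this into a contraction of ‖x‖² + ‖y‖² at rate 4/t (`one_step_le`).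

The expectation of ⟨g, x⟩ need not be nonnegative, because sampling without replacement correlates x
with the samples that are left. By exchangeability, the mini-batch average may be replaced there by
the average over all positions from which the node has not drawn yet (`integral_inner_average_eq`).
Its mean part is nonnegative against x by optimality of `wStar`. Its centred part has second moment
at most the squared norm bound over the number of remaining positions, since the values at distinct
positions are negatively correlated. Young's inequality absorbs it at the cost of half of the
contraction of ‖x‖² (`neg_integral_inner_batchGrad_le`), and summing these errors over time gives
the logarithm.

The noise variance is of order 1/r², where r - 1 is the step of the node's last global update. Every
step renews r with probability at least a, so the expectation of 1/r² relaxes to order 1/t² once a²t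
≥ 1 (`relaxation_le`, `integral_inv_last_le`). Before that, the diameter bound 2B/γ on the
hypothesis space is already as good as the claim.

Altogether the mean D satisfies D(t+1) ≤ (1 - 2/(t+1)) D(t) + M · error, and multiplication by
(t+1)² makes this telescope (`sq_mul_integral_sqDist_le`). -/

noncomputable section

namespace DeepQSGD

/-! ### Euclidean projection onto a closed convex set -/

section Projection

variable {d : ℕ} {W : Set (Vec d)}

/-- A nearest point exists by properness of the space, so `proj` takes its first branch; convexity
turns minimality into the variational inequality. -/
lemma proj_spec (hne : W.Nonempty) (hc : IsClosed W) (hW : Convex ℝ W) (x : Vec d) :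
    proj W x ∈ W ∧ ∀ z ∈ W, inner ℝ (x - proj W x) (z - proj W x) ≤ 0 := by
  have hex : ∃ y ∈ W, ∀ z ∈ W, ‖x - y‖ ≤ ‖x - z‖ := by
    obtain ⟨y, hy, h⟩ := hc.exists_infDist_eq_dist hne x
    refine ⟨y, hy, fun z hz => ?_⟩
    rw [← dist_eq_norm, ← dist_eq_norm, ← h]
    exact Metric.infDist_le_dist_of_mem hz
  have hp : proj W x = hex.choose := dif_pos hex
  obtain ⟨h1, h2⟩ := hex.choose_spec
  rw [← hp] at h1 h2
  refine ⟨h1, (norm_eq_iInf_iff_real_inner_le_zero hW h1).1 (le_antisymm ?_ ?_)⟩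
  · have : Nonempty W := ⟨⟨_, h1⟩⟩
    exact le_ciInf fun w => h2 _ w.2
  · exact ciInf_le (f := fun w : W => ‖x - w‖) ⟨0, by rintro _ ⟨w, rfl⟩; positivity⟩ ⟨_, h1⟩

/-- Testing each variational inequality with the other projection and adding gives ‖u - v‖² ≤ ⟨x -
y, u - v⟩; Cauchy–Schwarz concludes. -/
lemma norm_proj_sub_proj_le (hne : W.Nonempty) (hc : IsClosed W) (hW : Convex ℝ W) (x y : Vec d) :
    ‖proj W x - proj W y‖ ≤ ‖x - y‖ := by
  obtain ⟨hx, hx'⟩ := proj_spec hne hc hW x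
  obtain ⟨hy, hy'⟩ := proj_spec hne hc hW y
  have h1 := hx' _ hy
  have h2 := hy' _ hx
  set u := proj W x
  set v := proj W y
  have h3 : inner ℝ (x - y) (u - v) - ‖u - v‖ ^ 2 ≥ 0 := by
    have : inner ℝ (x - y) (u - v) - ‖u - v‖ ^ 2
        = - inner ℝ (x - u) (v - u) - inner ℝ (y - v) (u - v) := by
      rw [← real_inner_self_eq_norm_sq]
      simp only [inner_sub_left, inner_sub_right]
      ring
    linarith
  have h4 := real_inner_le_norm (x - y) (u - v)
  rcases (norm_nonneg (u - v)).eq_or_lt with h0 | h0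
  · rw [← h0]; positivity
  · nlinarith

lemma proj_eq_self (hne : W.Nonempty) (hc : IsClosed W) (hW : Convex ℝ W) {w : Vec d}
    (hw : w ∈ W) : proj W w = w := by
  have h := (proj_spec hne hc hW w).2 w hw
  rw [real_inner_self_nonpos, sub_eq_zero] at h
  exact h.symm

lemma norm_proj_sub_le (hc : IsClosed W) (hW : Convex ℝ W) (x : Vec d) {w : Vec d} (hw : w ∈ W) :
    ‖proj W x - w‖ ≤ ‖x - w‖ := by
  simpa [proj_eq_self ⟨w, hw⟩ hc hW hw] using norm_proj_sub_proj_le ⟨w, hw⟩ hc hW x w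

lemma measurable_proj (hne : W.Nonempty) (hc : IsClosed W) (hW : Convex ℝ W) :
    Measurable (proj W) := by
  have : LipschitzWith 1 (proj W) := LipschitzWith.of_dist_le_mul fun x y => by
    simpa [dist_eq_norm] using norm_proj_sub_proj_le hne hc hW x y
  exact this.continuous.measurable

end Projection

/-! ### Strong monotonicity, diameter of the hypothesis space, first-order optimality -/

section Gradient

variable {d n : ℕ} {W : Set (Vec d)} {γ : ℝ}

lemma measurable_gradient (f : Vec d → ℝ) : Measurable (gradient f) := by
  have : gradient f = fun x => (InnerProductSpace.toDual ℝ (Vec d)).symm (fderiv ℝ f x) := rfl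
  rw [this]
  exact (InnerProductSpace.toDual ℝ (Vec d)).symm.continuous.measurable.comp
    (measurable_fderiv ℝ f)

lemma StronglyConvex.inner_gradient_sub {f : Vec d → ℝ} (hf : StronglyConvex W γ f)
    {u v : Vec d} (hu : u ∈ W) (hv : v ∈ W) :
    γ * ‖u - v‖ ^ 2 ≤ inner ℝ (gradient f u - gradient f v) (u - v) := by
  have h1 := hf.2 u hu v hv
  have h2 := hf.2 v hv u hu
  rw [norm_sub_rev v u, ← neg_sub u v, inner_neg_right] at h2
  rw [inner_sub_left]
  linarith

/-- Strong monotonicity against bounded gradients bounds the diameter of `W`. This makes all moments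
finite and settles the early steps. -/
lemma StronglyConvex.norm_sub_le {f : Vec d → ℝ} (hf : StronglyConvex W γ f) (hγ : 0 < γ) {B : ℝ}
    (hB : ∀ w ∈ W, ‖gradient f w‖ ≤ B) {u v : Vec d} (hu : u ∈ W) (hv : v ∈ W) :
    ‖u - v‖ ≤ 2 * B / γ := by
  have h1 := hf.inner_gradient_sub hu hv
  have h2 := real_inner_le_norm (gradient f u - gradient f v) (u - v)
  have h3 := _root_.norm_sub_le (gradient f u) (gradient f v)
  have h4 := hB u hu
  have h5 := hB v hv
  rw [le_div_iff₀ hγ]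
  rcases (norm_nonneg (u - v)).eq_or_lt with h0 | h0
  · rw [← h0]; nlinarith [norm_nonneg (gradient f u)]
  · have : ‖gradient f u - gradient f v‖ ≤ 2 * B := by linarith
    have : γ * ‖u - v‖ ^ 2 ≤ 2 * B * ‖u - v‖ := by nlinarith
    nlinarith

/-- The segment from the minimizer to `w` stays in `W`, so the derivative in that direction cannot
be negative. -/
lemma inner_sum_gradient_nonneg (hW : Convex ℝ W) {f : Fin n → Vec d → ℝ}
    {w₀ : Vec d} (hf : ∀ i, DifferentiableAt ℝ (f i) w₀) (hn : 0 < n) (hw₀ : w₀ ∈ W)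
    (hmin : ∀ w ∈ W, empiricalRisk f w₀ ≤ empiricalRisk f w) {w : Vec d} (hw : w ∈ W) :
    0 ≤ inner ℝ (∑ i, gradient (f i) w₀) (w - w₀) := by
  have hsum : HasFDerivAt (fun w => ∑ i, f i w) (∑ i, fderiv ℝ (f i) w₀) w₀ :=
    HasFDerivAt.fun_sum fun i _ => (hf i).hasFDerivAt
  have hloc : IsLocalMinOn (fun w => ∑ i, f i w) W w₀ := by
    refine Filter.eventually_of_mem self_mem_nhdsWithin fun z hz => ?_
    have h := hmin z hz
    unfold empiricalRisk at h
    exact le_of_mul_le_mul_left h (by positivity)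
  have h := hloc.hasFDerivWithinAt_nonneg hsum.hasFDerivWithinAt
    (sub_mem_posTangentConeAt_of_segment_subset (hW.segment_subset hw₀ hw))
  rw [sum_apply] at h
  rw [sum_inner]
  refine h.trans_eq (Finset.sum_congr rfl fun i _ => ?_)
  rw [← toDual_gradient, InnerProductSpace.toDual_apply_apply]

end Gradient

/-! ### The deterministic inequality for one update -/

section OneStep

variable {E : Type*} [NormedAddCommGroup E] [InnerProductSpace ℝ E]

/-- One update in which a node moves along the (strongly monotone) gradient at its local model with
probability `p`, and otherwise averages and moves along the gradient at the global model. -/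
lemma one_step_le {x y gx gy gs : E} {p a γ η B t : ℝ} (hγ : 0 < γ) (ha : 0 < a) (ht : 0 < t)
    (hη : η = 1 / (a * γ * t)) (hp : a ≤ p) (hp' : a ≤ 1 - p)
    (hx : γ * ‖x‖ ^ 2 ≤ inner ℝ (gx - gs) x) (hy : γ * ‖y‖ ^ 2 ≤ inner ℝ (gy - gs) y)
    (hgx : ‖gx‖ ≤ B) (hgy : ‖gy‖ ≤ B) (hgs : ‖gs‖ ≤ B) :
    p * (‖x - (2 * η) • gx‖ ^ 2 + ‖y‖ ^ 2)
        + (1 - p) * (2 * ‖(1 / 2 : ℝ) • (x + y) - η • gy‖ ^ 2)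
      ≤ ‖x‖ ^ 2 + ‖y‖ ^ 2 - 4 / t * (‖x‖ ^ 2 + ‖y‖ ^ 2) - 4 * η * inner ℝ gs x
        + 20 * η ^ 2 * B ^ 2 := by
  have hη0 : 0 < η := by rw [hη]; positivity
  have hat : η * γ * a = 1 / t := by rw [hη]; field_simp
  have hp0 : 0 < p := ha.trans_le hp
  have hp0' : 0 < 1 - p := ha.trans_le hp'
  have hB : 0 ≤ B := (norm_nonneg _).trans hgx
  have hgx2 : ‖gx‖ ^ 2 ≤ B ^ 2 := by gcongr
  have hgy2 : ‖gy‖ ^ 2 ≤ B ^ 2 := by gcongr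
  rw [inner_sub_left] at hx hy
  have key1 : ‖x - (2 * η) • gx‖ ^ 2 ≤ ‖x‖ ^ 2 - 4 * η * γ * ‖x‖ ^ 2 - 4 * η * inner ℝ gs x
      + 4 * η ^ 2 * B ^ 2 := by
    rw [norm_sub_sq_real, inner_smul_right, norm_smul, real_inner_comm, Real.norm_eq_abs, mul_pow,
      sq_abs]
    nlinarith [mul_le_mul_of_nonneg_left hx hη0.le, mul_le_mul_of_nonneg_left hgx2 (sq_nonneg η)]
  -- The price of having ⟨gs, x⟩ instead of ⟨gs, y⟩ in the averaging branch; completing the square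
  -- yields 18 = 6²/2.
  have hv : - ‖x - y‖ ^ 2 / 2 + η * inner ℝ ((4 : ℝ) • gs - (2 : ℝ) • gy) (x - y)
      ≤ 18 * η ^ 2 * B ^ 2 := by
    have h1 := real_inner_le_norm ((4 : ℝ) • gs - (2 : ℝ) • gy) (x - y)
    have h2 : ‖(4 : ℝ) • gs - (2 : ℝ) • gy‖ ≤ 6 * B := by
      refine (norm_sub_le _ _).trans ?_
      rw [norm_smul, norm_smul]
      norm_num
      linarith
    have h3 := mul_le_mul_of_nonneg_right h2 (norm_nonneg (x - y))
    have h4 := mul_le_mul_of_nonneg_left (h1.trans h3) hη0.le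
    nlinarith [sq_nonneg (‖x - y‖ - 6 * η * B)]
  have key2 : 2 * ‖(1 / 2 : ℝ) • (x + y) - η • gy‖ ^ 2 ≤ ‖x‖ ^ 2 + ‖y‖ ^ 2
      - 4 * η * γ * ‖y‖ ^ 2 - 4 * η * inner ℝ gs x + 20 * η ^ 2 * B ^ 2 := by
    have e1 : ‖(1 / 2 : ℝ) • (x + y) - η • gy‖ ^ 2 = ‖x + y‖ ^ 2 / 4 - η * inner ℝ gy (x + y)
        + η ^ 2 * ‖gy‖ ^ 2 := by
      rw [norm_sub_sq_real, inner_smul_right, inner_smul_left, norm_smul, norm_smul,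
        real_inner_comm, mul_pow, mul_pow, Real.norm_eq_abs, Real.norm_eq_abs, sq_abs, sq_abs]
      simp
      ring
    have e2 : ‖x + y‖ ^ 2 = 2 * ‖x‖ ^ 2 + 2 * ‖y‖ ^ 2 - ‖x - y‖ ^ 2 := by
      have := parallelogram_law_with_norm ℝ x y
      nlinarith
    rw [inner_sub_left, real_inner_smul_left, real_inner_smul_left, inner_sub_right,
      inner_sub_right] at hv
    rw [e1, e2, inner_add_right]
    have m1 := mul_le_mul_of_nonneg_left hy hη0.le
    have m2 := mul_le_mul_of_nonneg_left hgy2 (sq_nonneg η)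
    linarith
  have h1 := mul_le_mul_of_nonneg_left key1 hp0.le
  have h2 := mul_le_mul_of_nonneg_left key2 hp0'.le
  -- Each branch contracts only one of the two terms; the lower bound `a` on its probability makes
  -- the rate 1/t for both.
  have h3 : 1 / t * ‖x‖ ^ 2 ≤ η * γ * p * ‖x‖ ^ 2 := by rw [← hat]; gcongr
  have h4 : 1 / t * ‖y‖ ^ 2 ≤ η * γ * (1 - p) * ‖y‖ ^ 2 := by rw [← hat]; gcongr
  have h5 : p * (4 * η ^ 2 * B ^ 2) + (1 - p) * (20 * η ^ 2 * B ^ 2) ≤ 20 * η ^ 2 * B ^ 2 := by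
    nlinarith [mul_nonneg hp0.le (mul_nonneg (sq_nonneg η) (sq_nonneg B))]
  have h6 : 4 / t = 4 * (1 / t) := by ring
  rw [h6]
  clear hat hη hx hy key1 key2 hv hgx hgy hgs hgx2 hgy2
  generalize ‖x - (2 * η) • gx‖ ^ 2 = K₁ at *
  generalize ‖(1 / 2 : ℝ) • (x + y) - η • gy‖ ^ 2 = K₂ at *
  generalize ‖x‖ ^ 2 = X at *
  generalize ‖y‖ ^ 2 = Y at *
  generalize (inner ℝ gs x : ℝ) = I at *
  generalize 1 / t = r at *
  linarith

end OneStep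

/-! ### Scalar recursions -/

section Recursion

/-- Decay of a sequence that relaxes to `1 / (t + 1) ^ 2` at rate `a`. -/
lemma relaxation_le {a : ℝ} (ha : 0 < a) {u : ℕ → ℝ} {T : ℕ} (h1 : ∀ t, u t ≤ 1)
    (hu : ∀ t, t + 1 ≤ T → u (t + 1) ≤ (1 - a) * u t + a / ((t : ℝ) + 2) ^ 2) (ha1 : a ≤ 1)
    {t : ℕ} (ht : t ≤ T) :
    u t ≤ 2 / ((t : ℝ) + 1) ^ 2 + 256 / (a ^ 4 * ((t : ℝ) + 1) ^ 4) := by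
  -- Since 256 = 4⁴, the second term alone exceeds the trivial bound 1 as long as a(s + 1) ≤ 4.
  have small : ∀ s : ℕ, a * ((s : ℝ) + 1) ≤ 4 →
      u s ≤ 2 / ((s : ℝ) + 1) ^ 2 + 256 / (a ^ 4 * ((s : ℝ) + 1) ^ 4) := by
    intro s hs
    refine (h1 s).trans ?_
    have : 1 ≤ 256 / (a ^ 4 * ((s : ℝ) + 1) ^ 4) := by
      rw [one_le_div (by positivity), ← mul_pow]
      calc (a * ((s : ℝ) + 1)) ^ 4 ≤ 4 ^ 4 := by gcongr
        _ = 256 := by norm_num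
    have : 0 ≤ 2 / ((s : ℝ) + 1) ^ 2 := by positivity
    linarith
  induction t with
  | zero => exact small 0 (by push_cast; linarith)
  | succ t ih =>
    rcases le_or_gt (a * (((t + 1 : ℕ) : ℝ) + 1)) 4 with hs | hs
    · exact small _ hs
    refine (hu t ht).trans ?_
    have ih := mul_le_mul_of_nonneg_left (ih (by omega)) (sub_nonneg.2 ha1)
    push_cast at hs ⊢
    set q : ℝ := (t : ℝ) + 1 with hq
    have hq0 : 1 ≤ q := by rw [hq]; linarith [(t.cast_nonneg : (0 : ℝ) ≤ t)]
    have e : (t : ℝ) + 2 = q + 1 := by rw [hq]; ring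
    rw [e]
    -- Uses a(q + 1) > 4. Together with 1 - a ≤ (1 - a/2)² it propagates both terms separately: the
    -- quadratic one also absorbs the forcing, the quartic one is a supersolution of the homogeneous
    -- recursion.
    have hb : (1 - a / 2) * (q + 1) ^ 2 ≤ q ^ 2 := by nlinarith
    have h2 : (1 - a) * (2 / q ^ 2) + a / (q + 1) ^ 2 ≤ 2 / (q + 1) ^ 2 := by
      have h3 : (1 - a) * (q + 1) ^ 2 ≤ (1 - a / 2) * q ^ 2 := by
        have : 1 - a ≤ (1 - a / 2) * (1 - a / 2) := by nlinarith
        calc (1 - a) * (q + 1) ^ 2 ≤ (1 - a / 2) * (1 - a / 2) * (q + 1) ^ 2 := by gcongr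
          _ = (1 - a / 2) * ((1 - a / 2) * (q + 1) ^ 2) := by ring
          _ ≤ (1 - a / 2) * q ^ 2 := by
            apply mul_le_mul_of_nonneg_left hb; linarith
      have h4 : (1 - a) * (2 / q ^ 2) ≤ (2 - a) / (q + 1) ^ 2 := by
        rw [mul_div_assoc', div_le_div_iff₀ (by positivity) (by positivity)]
        nlinarith
      have : (2 - a) / (q + 1) ^ 2 + a / (q + 1) ^ 2 = 2 / (q + 1) ^ 2 := by
        rw [← add_div]; ring_nf
      linarith
    have h3 : (1 - a) * (256 / (a ^ 4 * q ^ 4)) ≤ 256 / (a ^ 4 * (q + 1) ^ 4) := by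
      have h5 : (1 - a) * (q + 1) ^ 4 ≤ q ^ 4 := by
        have h6 : 1 - a ≤ (1 - a / 2) * (1 - a / 2) := by nlinarith
        have h7 : 0 ≤ (1 - a / 2) * (q + 1) ^ 2 := by
          apply mul_nonneg (by linarith) (by positivity)
        calc (1 - a) * (q + 1) ^ 4 ≤ (1 - a / 2) * (1 - a / 2) * (q + 1) ^ 4 := by gcongr
          _ = ((1 - a / 2) * (q + 1) ^ 2) ^ 2 := by ring
          _ ≤ (q ^ 2) ^ 2 := by gcongr
          _ = q ^ 4 := by ring
      rw [mul_div_assoc', div_le_div_iff₀ (by positivity) (by positivity)]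
      have := mul_le_mul_of_nonneg_left h5 (by positivity : 0 ≤ 256 * a ^ 4)
      nlinarith
    rw [mul_add] at ih
    linarith

/-- Each summand is at most t/(t - s), so the sum is at most t times a harmonic number, read
backwards. This is the source of log t. -/
lemma sum_div_le {T t : ℕ} (h : t ≤ T) (ht : 1 ≤ t) :
    ∑ s ∈ Finset.range t, ((s : ℝ) + 1) / ((T : ℝ) - s) ≤ t * (1 + Real.log t) := by
  have h1 : ∑ s ∈ Finset.range t, ((s : ℝ) + 1) / ((T : ℝ) - s)
      ≤ ∑ s ∈ Finset.range t, (t : ℝ) * (((t - 1 - s + 1 : ℕ) : ℝ)⁻¹) := by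
    refine Finset.sum_le_sum fun s hs => ?_
    have hs := Finset.mem_range.1 hs
    have e : ((t - 1 - s + 1 : ℕ) : ℝ) = t - s := by
      rw [show t - 1 - s + 1 = t - s by omega, Nat.cast_sub hs.le]
    have h2 : (0 : ℝ) < (t : ℝ) - s := by
      rw [sub_pos]; exact_mod_cast hs
    have h3 : (t : ℝ) ≤ T := by exact_mod_cast h
    have h4 : (s : ℝ) + 1 ≤ t := by exact_mod_cast hs
    rw [e, ← div_eq_mul_inv]
    gcongr
  refine h1.trans ?_
  rw [← Finset.mul_sum]
  gcongr
  have h5 := Finset.sum_range_reflect (fun j : ℕ => ((j + 1 : ℕ) : ℝ)⁻¹) t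
  rw [h5]
  have := harmonic_le_one_add_log t
  rw [harmonic] at this
  push_cast at this ⊢
  exact this

end Recursion


/-! ### Bounds on noise, mini-batches and gradients -/

namespace Setup

variable {d n M : ℕ} (S : Setup d n M)

/-- The standing assumptions on the data of a run of `T` steps. -/
structure Regular (B : ℝ) (T : ℕ) : Prop where
  n_pos : 0 < n
  M_pos : 0 < M
  dvd : M ∣ n
  b_pos : 0 < S.b
  T_mul_le : T * S.b ≤ n / M
  isClosed : IsClosed S.W
  convex : Convex ℝ S.W
  initLocal_mem : ∀ m, S.initLocal m ∈ S.W
  initGlobal_mem : S.initGlobal ∈ S.W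
  γ_pos : 0 < S.γ
  a_pos : 0 < S.a
  L_nonneg : 0 ≤ S.L
  ε_pos : 0 < S.ε
  δ_pos : 0 < S.δ
  δ_lt_one : S.δ < 1
  stronglyConvex : ∀ i, StronglyConvex S.W S.γ (S.f i)
  norm_gradient_le : ∀ i, ∀ w ∈ S.W, ‖gradient (S.f i) w‖ ≤ B

variable {S} {B : ℝ} {T : ℕ}

namespace Regular

variable (hS : S.Regular B T)
include hS

lemma nonempty : S.W.Nonempty := ⟨_, hS.initGlobal_mem⟩

lemma norm_sub_le {u v : Vec d} (hu : u ∈ S.W) (hv : v ∈ S.W) : ‖u - v‖ ≤ 2 * B / S.γ :=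
  (hS.stronglyConvex ⟨0, hS.n_pos⟩).norm_sub_le hS.γ_pos (hS.norm_gradient_le _) hu hv

lemma norm_sub_sq_le {u v : Vec d} (hu : u ∈ S.W) (hv : v ∈ S.W) :
    ‖u - v‖ ^ 2 ≤ (2 * B / S.γ) ^ 2 := by
  have := hS.norm_sub_le hu hv
  gcongr

lemma B_nonneg : 0 ≤ B :=
  (norm_nonneg _).trans (hS.norm_gradient_le ⟨0, hS.n_pos⟩ _ hS.initGlobal_mem)

lemma log_pos : 0 < Real.log (1.25 / S.δ) := by
  apply Real.log_pos
  rw [lt_div_iff₀ hS.δ_pos]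
  linarith [hS.δ_lt_one]

lemma stepSize_pos {t : ℕ} (ht : 1 ≤ t) : 0 < S.stepSize t := by
  have h1 := hS.γ_pos
  have h2 := hS.a_pos
  have h3 : (0 : ℝ) < t := by exact_mod_cast ht
  unfold stepSize
  positivity

lemma stepSize_nonneg (t : ℕ) : 0 ≤ S.stepSize t := by
  have h1 := hS.γ_pos
  have h2 := hS.a_pos
  unfold stepSize
  positivity

lemma sensitivity_nonneg (r t : ℕ) : 0 ≤ S.sensitivity r t := by
  refine Real.iSup_nonneg fun k => ?_
  have h1 := hS.stepSize_nonneg k.1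
  have h2 := hS.L_nonneg
  positivity

/-- The step sizes decrease, so the maximum is governed by its first index. An empty range of
indices has supremum 0. -/
lemma sensitivity_le {r : ℕ} (hr : 1 ≤ r) (t : ℕ) :
    S.sensitivity r t ≤ 2 * S.stepSize r * S.L / S.b := by
  have h1 := hS.γ_pos
  have h2 := hS.a_pos
  have h3 := hS.L_nonneg
  have h4 : (0 : ℝ) < r := by exact_mod_cast hr
  refine Real.iSup_le (fun k => ?_) ?_
  · have h5 : (r : ℝ) ≤ (k.1 : ℝ) := by exact_mod_cast (Finset.mem_Icc.1 k.2).1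
    unfold stepSize
    gcongr
  · have := hS.stepSize_nonneg r
    positivity

lemma noiseStd_sq_le {r : ℕ} (hr : 1 ≤ r) (t : ℕ) :
    S.noiseStd r t ^ 2 ≤ 8 * S.L ^ 2 * Real.log (1.25 / S.δ) /
      (S.a ^ 2 * S.γ ^ 2 * (S.b : ℝ) ^ 2 * S.ε ^ 2) * (1 / (r : ℝ) ^ 2) := by
  have h1 := hS.log_pos
  have h2 := hS.sensitivity_le hr t
  have h3 := hS.sensitivity_nonneg r t
  have h4 := hS.ε_pos
  have e : S.noiseStd r t ^ 2
      = 2 * Real.log (1.25 / S.δ) * S.sensitivity r t ^ 2 / S.ε ^ 2 := by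
    unfold noiseStd
    rw [div_pow, mul_pow, Real.sq_sqrt (by positivity)]
  rw [e]
  calc 2 * Real.log (1.25 / S.δ) * S.sensitivity r t ^ 2 / S.ε ^ 2
      ≤ 2 * Real.log (1.25 / S.δ) * (2 * S.stepSize r * S.L / S.b) ^ 2 / S.ε ^ 2 := by gcongr
    _ = _ := by
      have h5 := hS.γ_pos.ne'
      have h6 := hS.a_pos.ne'
      have h7 : (S.b : ℝ) ≠ 0 := by exact_mod_cast hS.b_pos.ne'
      have h8 : (r : ℝ) ≠ 0 := by exact_mod_cast (show r ≠ 0 by omega)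
      have h9 := h4.ne'
      unfold stepSize
      field_simp
      ring

/-- All mini-batches up to step `T` are full because `T * S.b` does not exceed the number of samples
of a node. -/
lemma card_batch {t : ℕ} (ht : t + 1 ≤ T) : (S.batch (n := n) (M := M) (t + 1)).card = S.b := by
  have hb := hS.b_pos
  have hle : (t + 1) * S.b ≤ n / M := (Nat.mul_le_mul_right _ ht).trans hS.T_mul_le
  have : (S.batch (n := n) (M := M) (t + 1)).map Fin.valEmbedding
      = Finset.Ico (t * S.b) ((t + 1) * S.b) := by
    ext k
    simp only [batch, Finset.mem_map, Finset.mem_filter, Finset.mem_univ, true_and,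
      Fin.valEmbedding_apply, Finset.mem_Ico, Nat.add_right_cancel_iff, Nat.div_eq_iff hb]
    constructor
    · rintro ⟨k, hk, rfl⟩
      rw [Nat.succ_mul]
      omega
    · rintro ⟨h1, h2⟩
      refine ⟨⟨k, h2.trans_le hle⟩, ?_, rfl⟩
      rw [Nat.succ_mul] at h2
      simp only
      omega
  rw [← Finset.card_map, this, Nat.card_Ico, Nat.succ_mul]
  omega

end Regular

variable (S) in
/-- The positions of the samples that a node has not drawn in the first `t` steps. -/
def remaining (t : ℕ) : Finset (Fin (n / M)) :=
  Finset.univ.filter fun k => t ≤ k.val / S.b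

lemma batch_succ_subset_remaining (t : ℕ) :
    S.batch (n := n) (M := M) (t + 1) ⊆ S.remaining t := by
  intro k hk
  simp only [batch, remaining, Finset.mem_filter, Finset.mem_univ, true_and] at hk ⊢
  omega

lemma notMem_batch_of_mem_remaining {t s : ℕ} (hs : s ≤ t) {k : Fin (n / M)}
    (hk : k ∈ S.remaining t) : k ∉ S.batch s := by
  simp only [batch, remaining, Finset.mem_filter, Finset.mem_univ, true_and] at hk ⊢
  omega

lemma Regular.le_card_remaining (hS : S.Regular B T) (t : ℕ) :
    (T - t) * S.b ≤ (S.remaining (n := n) (M := M) t).card := by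
  have hb := hS.b_pos
  have h := hS.T_mul_le
  have : Finset.Ico (t * S.b) (n / M)
      ⊆ (S.remaining (n := n) (M := M) t).map Fin.valEmbedding := by
    intro k hk
    simp only [remaining, Finset.mem_map, Finset.mem_filter, Finset.mem_univ, true_and,
      Fin.valEmbedding_apply, Finset.mem_Ico] at hk ⊢
    exact ⟨⟨k, hk.2⟩, (Nat.le_div_iff_mul_le hb).2 hk.1, rfl⟩
  have := Finset.card_le_card this
  rw [Finset.card_map, Nat.card_Ico] at this
  rw [Nat.sub_mul]
  omega

namespace Regular

variable (hS : S.Regular B T)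
include hS

lemma norm_batchGrad_le (α : Assignment n M) {t : ℕ} (ht : t + 1 ≤ T) (m : Fin M) {w : Vec d}
    (hw : w ∈ S.W) : ‖S.batchGrad α (t + 1) m w‖ ≤ B := by
  have hb : (0 : ℝ) < S.b := by exact_mod_cast hS.b_pos
  unfold batchGrad
  rw [norm_smul, Real.norm_of_nonneg (by positivity), one_div, inv_mul_le_iff₀ hb]
  refine (norm_sum_le _ _).trans ((Finset.sum_le_card_nsmul _ _ B
    fun k _ => hS.norm_gradient_le _ w hw).trans_eq ?_)
  rw [hS.card_batch ht, nsmul_eq_mul]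

lemma inner_batchGrad_sub (α : Assignment n M) {t : ℕ} (ht : t + 1 ≤ T) (m : Fin M) {u v : Vec d}
    (hu : u ∈ S.W) (hv : v ∈ S.W) :
    S.γ * ‖u - v‖ ^ 2
      ≤ inner ℝ (S.batchGrad α (t + 1) m u - S.batchGrad α (t + 1) m v) (u - v) := by
  have hb : (0 : ℝ) < S.b := by exact_mod_cast hS.b_pos
  unfold batchGrad
  rw [← smul_sub, ← Finset.sum_sub_distrib, real_inner_smul_left, sum_inner, one_div,
    le_inv_mul_iff₀ hb]
  refine Eq.trans_le ?_ (Finset.card_nsmul_le_sum _ _ (S.γ * ‖u - v‖ ^ 2)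
    fun k _ => (hS.stronglyConvex _).inner_gradient_sub hu hv)
  rw [hS.card_batch ht, nsmul_eq_mul]

end Regular

/-! ### Measurability of the mini-batch gradient -/

section Measurability

variable {Ω : Type*} [MeasurableSpace Ω]

lemma measurable_batchGrad {α : Ω → Assignment n M} (hα : Measurable α) {X : Ω → Vec d}
    (hX : Measurable X) (t : ℕ) (m : Fin M) :
    Measurable fun ω => S.batchGrad (α ω) t m (X ω) := by
  unfold batchGrad
  have h1 : Measurable fun q : Fin n × Vec d => gradient (S.f q.1) q.2 :=
    measurable_from_prod_countable_right fun i => measurable_gradient (S.f i)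
  have h2 (k : Fin (n / M)) : Measurable fun ω => α ω (m, k) :=
    (measurable_from_top (f := fun β : Assignment n M => β (m, k))).comp hα
  have h3 : Measurable fun ω => ∑ k ∈ S.batch t, gradient (S.f (α ω (m, k))) (X ω) :=
    Finset.measurable_fun_sum _ fun k _ => h1.comp ((h2 k).prodMk hX)
  exact h3.const_smul (1 / (S.b : ℝ))

end Measurability

/-! ### The run as a sequence of node updates: dependence, invariants, measurability -/

section Run

variable {Ξ : Type} (S) (p : ℕ → Fin M → Sample d n M Ξ → ℝ)

/-- The state when the first `k` nodes have acted in step `t + 1`. -/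
def stage (ω : Sample d n M Ξ) (t : ℕ) : ℕ → State d M
  | 0 => S.run p ω t
  | k + 1 =>
    if h : k < M then S.nodeUpdate p ω (t + 1) (stage ω t k) (S.order (t + 1) ⟨k, h⟩)
    else stage ω t k

lemma stage_succ (ω : Sample d n M Ξ) (t : ℕ) (j : Fin M) :
    S.stage p ω t (j + 1) = S.nodeUpdate p ω (t + 1) (S.stage p ω t j) (S.order (t + 1) j) := by
  rw [stage, dif_pos j.2]

lemma stage_eq_foldl (ω : Sample d n M Ξ) (t k : ℕ) :
    S.stage p ω t k = (((List.finRange M).take k).map (S.order (t + 1))).foldl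
      (S.nodeUpdate p ω (t + 1)) (S.run p ω t) := by
  induction k with
  | zero => simp [stage]
  | succ k ih =>
    by_cases h : k < M
    · rw [stage, dif_pos h, ih, List.take_add_one, List.map_append, List.foldl_append]
      simp [h]
    · rw [stage, dif_neg h, ih, List.take_of_length_le (by simp; omega),
        List.take_of_length_le (by simp; omega)]

lemma run_succ (ω : Sample d n M Ξ) (t : ℕ) : S.run p ω (t + 1) = S.stage p ω t M := by
  rw [stage_eq_foldl, List.take_of_length_le (by simp), run]

/-- The update of node `m` in step `s` is one of those made before the `(k + 1)`-st node acts in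
step `t + 1`. -/
def Done (t k s : ℕ) (m : Fin M) : Prop :=
  s ≤ t ∨ (s = t + 1 ∧ ((S.order s).symm m).val < k)

variable {S p}

/-- Two outcomes agree on the randomness used by the update of node `m` in step `s`. -/
def AgreeAt (S : Setup d n M) (s : ℕ) (m : Fin M) (ω ω' : Sample d n M Ξ) : Prop :=
  (∀ k ∈ S.batch s, ω.assign (m, k) = ω'.assign (m, k)) ∧
    ω.coin s m = ω'.coin s m ∧ ω.gauss s m = ω'.gauss s m

lemma batchGrad_congr {α α' : Assignment n M} {t : ℕ} {m : Fin M}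
    (h : ∀ k ∈ S.batch t, α (m, k) = α' (m, k)) (w : Vec d) :
    S.batchGrad α t m w = S.batchGrad α' t m w := by
  unfold batchGrad
  rw [Finset.sum_congr rfl fun k hk => by rw [h k hk]]

variable [MeasurableSpace Ξ]

lemma nodeUpdate_congr (hp : S.IsController p) {ω ω' : Sample d n M Ξ} {t : ℕ} {m : Fin M}
    (h : S.SameInfo t m ω ω') (h' : S.AgreeAt t m ω ω') (x : State d M) :
    S.nodeUpdate p ω t x m = S.nodeUpdate p ω' t x m := by
  simp only [nodeUpdate, h'.2.1, h'.2.2, (hp t m).2 ω ω' h, batchGrad_congr h'.1]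

omit [MeasurableSpace Ξ] in
/-- Induction along the sequence of all updates of a run. -/
lemma stage_induction {motive : ℕ → ℕ → Prop} (zero : motive 0 0)
    (update : ∀ t (j : Fin M), motive t j → motive t (j + 1))
    (next : ∀ t, motive t M → motive (t + 1) 0) (t k : ℕ) (hk : k ≤ M) : motive t k := by
  have inner : ∀ t, motive t 0 → ∀ k, k ≤ M → motive t k := by
    intro t h0 k
    induction k with
    | zero => exact fun _ => h0
    | succ k ih => exact fun hk => update t ⟨k, hk⟩ (ih (Nat.le_of_succ_le hk))
  refine inner t ?_ k hk
  induction t with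
  | zero => exact zero
  | succ t ih => exact next t (inner t ih M le_rfl)

/-- Adaptedness: a state is a function of the seed and of the randomness already consumed. The
invariance under `resample` and under `permute` both rest on it. -/
lemma stage_congr (hp : S.IsController p) {ω ω' : Sample d n M Ξ} (hseed : ω.seed = ω'.seed)
    (t k : ℕ) (hk : k ≤ M) (h : ∀ s m, 1 ≤ s → S.Done t k s m → S.AgreeAt s m ω ω') :
    S.stage p ω t k = S.stage p ω' t k := by
  revert h
  refine stage_induction (motive := fun t k => (∀ s m, 1 ≤ s → S.Done t k s m →
    S.AgreeAt s m ω ω') → S.stage p ω t k = S.stage p ω' t k) ?_ ?_ ?_ t k hk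
  · intro _; rfl
  · intro t j ih h
    have h1 : ∀ s m, 1 ≤ s → S.Done t j s m → S.AgreeAt s m ω ω' := fun s m hs hd =>
      h s m hs (hd.imp id fun ⟨e, hlt⟩ => ⟨e, hlt.trans (Nat.lt_succ_self _)⟩)
    have h2 : S.AgreeAt (t + 1) (S.order (t + 1) j) ω ω' :=
      h _ _ (by omega) (Or.inr ⟨rfl, by simp⟩)
    rw [stage_succ, stage_succ, ih h1]
    refine nodeUpdate_congr hp ⟨hseed, fun s m hs hb => h1 s m hs ?_, h2.1⟩ h2 _
    rcases hb with hb | ⟨rfl, hb⟩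
    · exact Or.inl (by omega)
    · exact Or.inr ⟨rfl, by simpa using hb⟩
  · intro t ih h
    change S.run p ω (t + 1) = S.run p ω' (t + 1)
    rw [run_succ, run_succ]
    refine ih fun s m hs hd => h s m hs (Or.inl ?_)
    rcases hd with hd | hd <;> omega

omit [MeasurableSpace Ξ] in
/-- A property of states that all updates preserve holds during the whole run. -/
lemma stage_invariant {Q : State d M → Prop} {ω : Sample d n M Ξ}
    (h0 : Q { loc := S.initLocal, glob := S.initGlobal, last := fun _ => 0 })
    (hu : ∀ t x m, Q x → Q (S.nodeUpdate p ω t x m)) (t k : ℕ) (hk : k ≤ M) :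
    Q (S.stage p ω t k) := by
  refine stage_induction (motive := fun t k => Q (S.stage p ω t k)) h0 ?_ ?_ t k hk
  · intro t j h
    rw [stage_succ]
    exact hu _ _ _ h
  · intro t h
    change Q (S.run p ω (t + 1))
    rwa [run_succ]

omit [MeasurableSpace Ξ] in
lemma Regular.stage_mem (hS : S.Regular B T) (ω : Sample d n M Ξ) (t k : ℕ) (hk : k ≤ M) :
    (∀ m, (S.stage p ω t k).loc m ∈ S.W) ∧ (S.stage p ω t k).glob ∈ S.W := by
  refine stage_invariant (Q := fun x => (∀ m, x.loc m ∈ S.W) ∧ x.glob ∈ S.W)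
    ⟨hS.initLocal_mem, hS.initGlobal_mem⟩ (fun t x m h => ?_) t k hk
  have hproj : ∀ y, proj S.W y ∈ S.W := fun y =>
    (proj_spec hS.nonempty hS.isClosed hS.convex y).1
  unfold nodeUpdate
  split_ifs
  · refine ⟨fun m' => ?_, h.2⟩
    rcases eq_or_ne m' m with rfl | hne
    · simpa using hproj _
    · simpa [hne] using h.1 m'
  · refine ⟨fun m' => ?_, hproj _⟩
    rcases eq_or_ne m' m with rfl | hne
    · simpa using hproj _
    · simpa [hne] using h.1 m'

omit [MeasurableSpace Ξ] in
lemma stage_last_le (ω : Sample d n M Ξ) (t k : ℕ) (hk : k ≤ M) (m : Fin M) :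
    (S.stage p ω t k).last m ≤ t + 1 := by
  refine stage_induction (motive := fun t k => ∀ m, (S.stage p ω t k).last m ≤ t + 1)
    (fun _ => Nat.zero_le _) ?_ ?_ t k hk m
  · intro t j h m
    rw [stage_succ, nodeUpdate]
    split_ifs
    · exact h m
    · rcases eq_or_ne m (S.order (t + 1) j) with rfl | hne
      · simp
      · simpa [hne] using h m
  · intro t h m
    change (S.run p ω (t + 1)).last m ≤ _
    rw [run_succ]
    exact (h m).trans (by omega)

omit [MeasurableSpace Ξ] in
lemma nodeUpdate_of_ne {ω : Sample d n M Ξ} {t : ℕ} {x : State d M} {m m' : Fin M}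
    (h : m' ≠ m) : (S.nodeUpdate p ω t x m).loc m' = x.loc m' ∧
      (S.nodeUpdate p ω t x m).last m' = x.last m' := by
  unfold nodeUpdate
  split_ifs <;> simp [h]

omit [MeasurableSpace Ξ] in
/-- A node's entries do not change between two moments of a step unless it acts in between. -/
lemma stage_eq_of_le (ω : Sample d n M Ξ) (t : ℕ) {k k' : ℕ} (hk : k ≤ k') (hk' : k' ≤ M)
    (j : Fin M) (hj : j.val < k ∨ k' ≤ j.val) :
    (S.stage p ω t k').loc (S.order (t + 1) j) = (S.stage p ω t k).loc (S.order (t + 1) j) ∧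
      (S.stage p ω t k').last (S.order (t + 1) j)
        = (S.stage p ω t k).last (S.order (t + 1) j) := by
  induction k', hk using Nat.le_induction with
  | base => exact ⟨rfl, rfl⟩
  | succ i hi ih =>
    obtain ⟨h1, h2⟩ := ih (by omega) (by omega)
    have hne : S.order (t + 1) j ≠ S.order (t + 1) ⟨i, hk'⟩ := by
      intro he
      have := congrArg Fin.val ((S.order (t + 1)).injective he)
      simp only at this
      omega
    have := stage_succ S p ω t ⟨i, hk'⟩
    simp only at this
    rw [this, ← h1, ← h2]
    exact nodeUpdate_of_ne hne

/-- All components of a random state are measurable. -/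
def MeasurableState (x : Sample d n M Ξ → State d M) : Prop :=
  (∀ m, Measurable fun ω => (x ω).loc m) ∧ (Measurable fun ω => (x ω).glob) ∧
    ∀ m, Measurable fun ω => (x ω).last m

omit [MeasurableSpace Ξ] in
lemma nodeUpdate_loc_self (ω : Sample d n M Ξ) (t : ℕ) (x : State d M) (m : Fin M) :
    (S.nodeUpdate p ω t x m).loc m = if ω.coin t m < p t m ω then
        proj S.W (x.loc m - (2 * S.stepSize t) • S.batchGrad ω.assign t m (x.loc m))
      else proj S.W ((1 / 2 : ℝ) • (x.glob + x.loc m) - S.stepSize t •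
        (S.batchGrad ω.assign t m x.glob
          + (S.noiseStd (x.last m + 1) t / S.stepSize t) • ω.gauss t m)) := by
  unfold nodeUpdate
  split_ifs <;> simp

omit [MeasurableSpace Ξ] in
lemma nodeUpdate_glob (ω : Sample d n M Ξ) (t : ℕ) (x : State d M) (m : Fin M) :
    (S.nodeUpdate p ω t x m).glob = if ω.coin t m < p t m ω then x.glob
      else proj S.W ((1 / 2 : ℝ) • (x.glob + x.loc m) - S.stepSize t •
        (S.batchGrad ω.assign t m x.glob
          + (S.noiseStd (x.last m + 1) t / S.stepSize t) • ω.gauss t m)) := by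
  unfold nodeUpdate
  split_ifs <;> rfl

omit [MeasurableSpace Ξ] in
lemma nodeUpdate_last_self (ω : Sample d n M Ξ) (t : ℕ) (x : State d M) (m : Fin M) :
    (S.nodeUpdate p ω t x m).last m = if ω.coin t m < p t m ω then x.last m else t := by
  unfold nodeUpdate
  split_ifs <;> simp

lemma measurable_assign : Measurable (Sample.assign (d := d) (n := n) (M := M) (Ξ := Ξ)) :=
  measurable_fst.comp measurable_snd

lemma measurable_coin (t : ℕ) (m : Fin M) :
    Measurable fun ω : Sample d n M Ξ => ω.coin t m :=
  measurable_fst.comp ((measurable_pi_apply (t, m)).comp (measurable_snd.comp measurable_snd))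

lemma measurable_gauss (t : ℕ) (m : Fin M) :
    Measurable fun ω : Sample d n M Ξ => ω.gauss t m :=
  measurable_snd.comp ((measurable_pi_apply (t, m)).comp (measurable_snd.comp measurable_snd))

lemma Regular.measurableState_nodeUpdate (hS : S.Regular B T) (hp : S.IsController p)
    {x : Sample d n M Ξ → State d M} (hx : MeasurableState x) (t : ℕ) (m : Fin M) :
    MeasurableState fun ω => S.nodeUpdate p ω t (x ω) m := by
  have hproj := measurable_proj hS.nonempty hS.isClosed hS.convex
  have hset : MeasurableSet {ω : Sample d n M Ξ | ω.coin t m < p t m ω} :=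
    measurableSet_lt (measurable_coin t m) (hp t m).1
  obtain ⟨hl, hg, hlast⟩ := hx
  have hstd : Measurable fun ω => S.noiseStd ((x ω).last m + 1) t / S.stepSize t :=
    (measurable_from_top (f := fun r : ℕ => S.noiseStd (r + 1) t / S.stepSize t)).comp (hlast m)
  have h1 : Measurable fun ω : Sample d n M Ξ => proj S.W ((x ω).loc m -
      (2 * S.stepSize t) • S.batchGrad ω.assign t m ((x ω).loc m)) :=
    hproj.comp ((hl m).sub
      ((measurable_batchGrad measurable_assign (hl m) t m).const_smul (2 * S.stepSize t)))
  have h2 : Measurable fun ω : Sample d n M Ξ =>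
      proj S.W ((1 / 2 : ℝ) • ((x ω).glob + (x ω).loc m) - S.stepSize t •
        (S.batchGrad ω.assign t m (x ω).glob
          + (S.noiseStd ((x ω).last m + 1) t / S.stepSize t) • ω.gauss t m)) := by
    have h3 := (measurable_batchGrad (S := S) measurable_assign hg t m).add
      (hstd.smul (measurable_gauss t m))
    exact hproj.comp (((hg.add (hl m)).const_smul (1 / 2 : ℝ)).sub (h3.const_smul (S.stepSize t)))
  refine ⟨fun m' => ?_, ?_, fun m' => ?_⟩
  · rcases eq_or_ne m' m with rfl | hne
    · simp only [nodeUpdate_loc_self]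
      exact Measurable.ite hset h1 h2
    · simp only [(nodeUpdate_of_ne hne).1]
      exact hl m'
  · simp only [nodeUpdate_glob]
    exact Measurable.ite hset hg h2
  · rcases eq_or_ne m' m with rfl | hne
    · simp only [nodeUpdate_last_self]
      exact Measurable.ite hset (hlast _) measurable_const
    · simp only [(nodeUpdate_of_ne hne).2]
      exact hlast m'

lemma Regular.measurableState_stage (hS : S.Regular B T) (hp : S.IsController p)
    (t k : ℕ) (hk : k ≤ M) : MeasurableState fun ω => S.stage p ω t k := by
  refine stage_induction (motive := fun t k => MeasurableState fun ω => S.stage p ω t k)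
    ⟨fun _ => measurable_const, measurable_const, fun _ => measurable_const⟩ ?_ ?_ t k hk
  · intro t j h
    simp only [stage_succ]
    exact hS.measurableState_nodeUpdate hp h _ _
  · intro t h
    change MeasurableState fun ω => S.run p ω (t + 1)
    simpa only [run_succ] using h

end Run

end Setup


/-! ### Second moments of the standard Gaussian vector -/

section Gaussian

variable {d : ℕ}

lemma integrable_norm_sub_smul_sq_stdGaussian (c : Vec d) (s : ℝ) :
    Integrable (fun g => ‖c - s • g‖ ^ 2) (stdGaussian (Vec d)) := by
  have h : MemLp (fun g : Vec d => c - s • g) 2 (stdGaussian (Vec d)) :=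
    (memLp_const c).sub (IsGaussian.memLp_two_id.const_smul s)
  exact h.norm.integrable_sq

lemma integral_norm_sq_stdGaussian : ∫ g, ‖g‖ ^ 2 ∂(stdGaussian (Vec d)) = d := by
  have h1 (i : Fin d) : ∫ g : Vec d, g i ^ 2 ∂(stdGaussian (Vec d)) = 1 := by
    have h := covarianceBilin_apply (μ := stdGaussian (Vec d)) IsGaussian.memLp_two_id
      (EuclideanSpace.single i (1 : ℝ)) (EuclideanSpace.single i (1 : ℝ))
    rw [covarianceBilin_stdGaussian] at h
    simp only [id, integral_id_stdGaussian, sub_zero] at h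
    rw [innerSL_apply_apply ℝ, real_inner_self_eq_norm_sq, PiLp.norm_single, norm_one,
      one_pow] at h
    simp only [EuclideanSpace.inner_single_left, map_one, one_mul] at h
    rw [h]
    exact integral_congr_ae (Filter.Eventually.of_forall fun g => by ring)
  -- A non-integrable function would have integral 0, but this integral is 1.
  have h2 (i : Fin d) : Integrable (fun g : Vec d => g i ^ 2) (stdGaussian (Vec d)) := by
    by_contra hc
    have := h1 i
    rw [integral_undef hc] at this
    exact zero_ne_one this
  simp_rw [EuclideanSpace.real_norm_sq_eq]
  rw [integral_finsetSum _ fun i _ => h2 i]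
  simp [h1]

lemma integral_norm_sub_smul_sq_stdGaussian (c : Vec d) (s : ℝ) :
    ∫ g, ‖c - s • g‖ ^ 2 ∂(stdGaussian (Vec d)) = ‖c‖ ^ 2 + d * s ^ 2 := by
  have hid : Integrable (fun g : Vec d => g) (stdGaussian (Vec d)) := IsGaussian.integrable_id
  have h1 : Integrable (fun g => ‖g‖ ^ 2) (stdGaussian (Vec d)) := by
    simpa using integrable_norm_sub_smul_sq_stdGaussian (0 : Vec d) 1
  have h2 : Integrable (fun g => inner ℝ c g) (stdGaussian (Vec d)) := hid.const_inner c
  have h3 : ∫ g, inner ℝ c g ∂(stdGaussian (Vec d)) = 0 := by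
    rw [integral_inner hid, integral_id_stdGaussian, inner_zero_right]
  have e : ∀ g : Vec d, ‖c - s • g‖ ^ 2 = ‖c‖ ^ 2 - 2 * s * inner ℝ c g + s ^ 2 * ‖g‖ ^ 2 := by
    intro g
    rw [norm_sub_sq_real, inner_smul_right, norm_smul, mul_pow, Real.norm_eq_abs, sq_abs]
    ring
  simp_rw [e]
  have h4 : Integrable (fun g => ‖c‖ ^ 2 - 2 * s * inner ℝ c g) (stdGaussian (Vec d)) :=
    (integrable_const _).sub (h2.const_mul _)
  rw [integral_add h4 (h1.const_mul _),
    integral_sub (integrable_const _) (h2.const_mul _), integral_const_mul, integral_const_mul, h3,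
    integral_norm_sq_stdGaussian]
  simp
  ring

end Gaussian

/-! ### Invariance of the law and conditioning on a single update -/

section Law

/-- The joint law of a coin and a Gaussian vector. -/
def nodeLaw (d : ℕ) : Measure (ℝ × Vec d) :=
  ((volume : Measure ℝ).restrict (Set.Icc 0 1)).prod (stdGaussian (Vec d))

instance : IsProbabilityMeasure ((volume : Measure ℝ).restrict (Set.Icc 0 1)) :=
  ⟨by simp⟩

instance (d : ℕ) : IsProbabilityMeasure (nodeLaw d) := by
  unfold nodeLaw; infer_instance

/-- Verified on finite boxes: a constraint on coordinate `e` moves to the fresh copy, which has the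
same law and is independent of the rest. -/
lemma measurePreserving_update {ι X : Type*} [DecidableEq ι] [MeasurableSpace X] (μ : Measure X)
    [IsProbabilityMeasure μ] (e : ι) :
    MeasurePreserving (fun q : (ι → X) × X => Function.update q.1 e q.2)
      ((Measure.infinitePi fun _ : ι => μ).prod μ) (Measure.infinitePi fun _ : ι => μ) := by
  have hm : Measurable fun q : (ι → X) × X => Function.update q.1 e q.2 := by
    refine measurable_pi_lambda _ fun i => ?_
    rcases eq_or_ne i e with rfl | h
    · simpa using measurable_snd
    · simpa [h, Function.comp_def] using (measurable_pi_apply i).comp measurable_fst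
  refine ⟨hm, Measure.eq_infinitePi _ fun s t ht => ?_⟩
  rw [Measure.map_apply hm (MeasurableSet.pi s.countable_toSet fun i _ => ht i)]
  by_cases he : e ∈ s
  · have : (fun q : (ι → X) × X => Function.update q.1 e q.2) ⁻¹' (Set.pi s t)
        = (Set.pi (s.erase e : Finset ι) t) ×ˢ t e := by
      ext q
      simp only [Set.mem_preimage, Set.mem_pi, Finset.mem_coe, Set.mem_prod, Finset.mem_erase]
      constructor
      · intro h
        exact ⟨fun i hi => by simpa [hi.1] using h i hi.2, by simpa using h e he⟩
      · rintro ⟨h1, h2⟩ i hi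
        rcases eq_or_ne i e with rfl | hne
        · simpa using h2
        · simpa [hne] using h1 i ⟨hne, hi⟩
    rw [this, Measure.prod_prod, Measure.infinitePi_pi _ fun i _ => ht i,
      Finset.prod_erase_mul _ _ he]
  · have : (fun q : (ι → X) × X => Function.update q.1 e q.2) ⁻¹' (Set.pi s t)
        = (Set.pi s t) ×ˢ Set.univ := by
      ext q
      simp only [Set.mem_preimage, Set.mem_pi, Finset.mem_coe, Set.mem_prod, Set.mem_univ, and_true]
      refine forall₂_congr fun i hi => ?_
      rw [Function.update_of_ne (ne_of_mem_of_not_mem hi he)]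
    rw [this, Measure.prod_prod, Measure.infinitePi_pi _ fun i _ => ht i, measure_univ, mul_one]

lemma measurePreserving_uniformOn {α : Type*} [Finite α] [MeasurableSpace α]
    [DiscreteMeasurableSpace α] (e : α ≃ α) :
    MeasurePreserving e (uniformOn (Set.univ : Set α)) (uniformOn (Set.univ : Set α)) := by
  have := Fintype.ofFinite α
  refine ⟨.of_discrete, Measure.ext fun s hs => ?_⟩
  rw [Measure.map_apply .of_discrete hs, uniformOn_univ, uniformOn_univ,
    Measure.count_apply .of_discrete, Measure.count_apply .of_discrete]
  congr 2
  rw [← e.image_symm_eq_preimage]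
  exact e.symm.injective.encard_image s

variable {d n M : ℕ} {Ξ : Type}

/-- Replace the coin and the Gaussian vector of index `e`. -/
def resample (e : ℕ × Fin M) (ω : Sample d n M Ξ) (ζ : ℝ × Vec d) : Sample d n M Ξ :=
  (ω.1, ω.2.1, Function.update ω.2.2 e ζ)

/-- Permute the positions of the samples. -/
def permute (σ : Equiv.Perm (Fin M × Fin (n / M))) (ω : Sample d n M Ξ) : Sample d n M Ξ :=
  (ω.1, σ.trans ω.2.1, ω.2.2)

instance (n M : ℕ) : DiscreteMeasurableSpace (Assignment n M) := ⟨fun _ => trivial⟩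

/-- Divisibility is what makes the set of assignments nonempty; otherwise the two index types differ
in cardinality. -/
lemma isProbabilityMeasure_uniformOn_assignment (h : M ∣ n) :
    IsProbabilityMeasure (uniformOn (Set.univ : Set (Assignment n M))) := by
  refine isProbabilityMeasure_uniformOn Set.finite_univ ?_
  have : Fintype.card (Fin M × Fin (n / M)) = Fintype.card (Fin n) := by
    simp [Nat.mul_div_cancel' h]
  exact ⟨Fintype.equivOfCardEq this, trivial⟩

variable [MeasurableSpace Ξ] (ν : Measure Ξ) [IsProbabilityMeasure ν]

lemma isProbabilityMeasure_law (h : M ∣ n) : IsProbabilityMeasure (law d n M ν) := by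
  have := isProbabilityMeasure_uniformOn_assignment h
  unfold law
  infer_instance

lemma measurePreserving_resample (h : M ∣ n) (e : ℕ × Fin M) :
    MeasurePreserving (fun q : Sample d n M Ξ × (ℝ × Vec d) => resample e q.1 q.2)
      ((law d n M ν).prod (nodeLaw d)) (law d n M ν) := by
  have := isProbabilityMeasure_uniformOn_assignment h
  have h1 := measurePreserving_update (nodeLaw d) e
  have h2 := ((MeasurePreserving.id (uniformOn (Set.univ : Set (Assignment n M)))).prod h1).comp
    (measurePreserving_prodAssoc _ _ _)
  exact ((MeasurePreserving.id ν).prod h2).comp (measurePreserving_prodAssoc _ _ _)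

lemma measurePreserving_permute (h : M ∣ n) (σ : Equiv.Perm (Fin M × Fin (n / M))) :
    MeasurePreserving (permute σ) (law d n M ν) (law d n M ν) := by
  have := isProbabilityMeasure_uniformOn_assignment h
  have h1 := measurePreserving_uniformOn (α := Assignment n M)
    (⟨fun α => σ.trans α, fun α => σ.symm.trans α, fun α => by ext; simp, fun α => by ext; simp⟩)
  exact (MeasurePreserving.id ν).prod (h1.prod (MeasurePreserving.id
    (Measure.infinitePi fun _ : ℕ × Fin M => nodeLaw d)))

variable {ν}

lemma integral_permute (h : M ∣ n) (σ : Equiv.Perm (Fin M × Fin (n / M)))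
    {H : Sample d n M Ξ → ℝ} (hH : Measurable H) :
    ∫ ω, H (permute σ ω) ∂(law d n M ν) = ∫ ω, H ω ∂(law d n M ν) := by
  have hm := measurePreserving_permute (d := d) ν h σ
  rw [← hm.map_eq, integral_map hm.measurable.aemeasurable hH.aestronglyMeasurable, hm.map_eq]

/-- To bound the expectation of a bounded variable it is enough to bound its conditional
expectation given all components but one coin and one Gaussian vector. -/
lemma integral_le_of_resample (h : M ∣ n) (e : ℕ × Fin M) {H R : Sample d n M Ξ → ℝ}
    (hH : Measurable H) {K : ℝ} (hK : ∀ ω, |H ω| ≤ K) (hR : Integrable R (law d n M ν))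
    (hHR : ∀ ω, ∫ ζ, H (resample e ω ζ) ∂(nodeLaw d) ≤ R ω) :
    ∫ ω, H ω ∂(law d n M ν) ≤ ∫ ω, R ω ∂(law d n M ν) := by
  have := isProbabilityMeasure_law (d := d) ν h
  have hm := measurePreserving_resample (d := d) ν h e
  have hHm : Measurable fun q : Sample d n M Ξ × (ℝ × Vec d) => H (resample e q.1 q.2) :=
    hH.comp hm.measurable
  have hint : Integrable (fun q : Sample d n M Ξ × (ℝ × Vec d) => H (resample e q.1 q.2))
      ((law d n M ν).prod (nodeLaw d)) :=
    Integrable.of_bound hHm.aestronglyMeasurable K (Filter.Eventually.of_forall fun q => hK _)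
  have h1 : ∫ ω, H ω ∂(law d n M ν)
      = ∫ ω, ∫ ζ, H (resample e ω ζ) ∂(nodeLaw d) ∂(law d n M ν) := by
    conv_lhs => rw [← hm.map_eq]
    rw [integral_map hm.measurable.aemeasurable hH.aestronglyMeasurable, integral_prod _ hint]
  rw [h1]
  exact integral_mono hint.integral_prod_left hR hHR

/-- The conditional expectation of a variable which is `c` if the coin falls below `q`, and is
bounded by a function of the Gaussian vector otherwise. -/
lemma integral_ite_le {q : ℝ} (hq0 : 0 ≤ q) (hq1 : q ≤ 1) {H : ℝ × Vec d → ℝ}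
    (c : ℝ) {G : Vec d → ℝ} (hG : Integrable G (stdGaussian (Vec d)))
    (hHm : Integrable H (nodeLaw d))
    (hH : ∀ ζ, H ζ ≤ if ζ.1 < q then c else G ζ.2) :
    ∫ ζ, H ζ ∂(nodeLaw d) ≤ q * c + (1 - q) * ∫ g, G g ∂(stdGaussian (Vec d)) := by
  have hr1 : (volume.restrict (Set.Icc (0 : ℝ) 1)).real (Set.Iio q) = q := by
    rw [measureReal_restrict_apply measurableSet_Iio]
    have : Set.Iio q ∩ Set.Icc (0 : ℝ) 1 = Set.Ico 0 q := by
      ext x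
      simp only [Set.mem_inter_iff, Set.mem_Iio, Set.mem_Icc, Set.mem_Ico]
      constructor
      · rintro ⟨h1, h2, _⟩; exact ⟨h2, h1⟩
      · rintro ⟨h1, h2⟩; exact ⟨h2, h1, by linarith⟩
    rw [this]
    simp [hq0]
  have hr2 : (volume.restrict (Set.Icc (0 : ℝ) 1)).real (Set.Iio q)ᶜ = 1 - q := by
    rw [probReal_compl_eq_one_sub measurableSet_Iio, hr1]
  have e : (fun ζ : ℝ × Vec d => if ζ.1 < q then c else G ζ.2)
      = fun ζ => (Set.Iio q).indicator (fun _ => c) ζ.1 * 1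
        + (Set.Iio q)ᶜ.indicator (fun _ => (1 : ℝ)) ζ.1 * G ζ.2 := by
    funext ζ
    by_cases h : ζ.1 < q
    · simp [h]
    · simp [h, Set.indicator, le_of_not_gt h]
  have i1 : Integrable ((Set.Iio q).indicator fun _ => c)
      ((volume : Measure ℝ).restrict (Set.Icc 0 1)) :=
    (integrable_const c).indicator measurableSet_Iio
  have i2 : Integrable ((Set.Iio q)ᶜ.indicator fun _ => (1 : ℝ))
      ((volume : Measure ℝ).restrict (Set.Icc 0 1)) :=
    (integrable_const 1).indicator measurableSet_Iio.compl
  have j1 := i1.mul_prod (integrable_const (μ := stdGaussian (Vec d)) (1 : ℝ))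
  have j2 := i2.mul_prod hG
  calc ∫ ζ, H ζ ∂(nodeLaw d) ≤ ∫ ζ, (if ζ.1 < q then c else G ζ.2) ∂(nodeLaw d) := by
        refine integral_mono hHm ?_ hH
        rw [e]
        exact j1.add j2
    _ = _ := by
        unfold nodeLaw
        rw [e, integral_add j1 j2, integral_prod_mul (fun x => (Set.Iio q).indicator (fun _ => c) x)
          (fun _ : Vec d => (1 : ℝ)), integral_prod_mul
          (fun x => (Set.Iio q)ᶜ.indicator (fun _ => (1 : ℝ)) x) G,
          integral_indicator_const _ measurableSet_Iio,
          integral_indicator_const _ measurableSet_Iio.compl, hr1, hr2]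
        simp

end Law

/-! ### Sampling without replacement -/

section Sampling

variable {d n M : ℕ} {Ξ : Type} [MeasurableSpace Ξ] {ν : Measure Ξ} [IsProbabilityMeasure ν]

lemma measurable_inner_assign (h : Fin n → Vec d) (q : Fin M × Fin (n / M))
    {X : Sample d n M Ξ → Vec d} (hX : Measurable X) :
    Measurable fun ω => (inner ℝ (h (ω.assign q)) (X ω) : ℝ) := by
  have h1 : Measurable fun ω : Sample d n M Ξ => h (ω.assign q) :=
    (measurable_from_top (f := fun β : Assignment n M => h (β q))).comp Setup.measurable_assign
  exact h1.inner hX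

lemma integrable_inner_assign (hd : M ∣ n) (h : Fin n → Vec d) (q : Fin M × Fin (n / M))
    {X : Sample d n M Ξ → Vec d} (hX : Measurable X) {K : ℝ} (hK : ∀ ω, ‖X ω‖ ≤ K) :
    Integrable (fun ω => (inner ℝ (h (ω.assign q)) (X ω) : ℝ)) (law d n M ν) := by
  have := isProbabilityMeasure_law (d := d) ν hd
  refine Integrable.of_bound (measurable_inner_assign h q hX).aestronglyMeasurable
    ((∑ i, ‖h i‖) * K) (Filter.Eventually.of_forall fun ω => ?_)
  refine (norm_inner_le_norm _ _).trans (mul_le_mul ?_ (hK ω) (norm_nonneg _) (by positivity))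
  exact Finset.single_le_sum (f := fun i => ‖h i‖) (fun i _ => norm_nonneg _) (Finset.mem_univ _)

/-- Sampling without replacement: the values at two positions are negatively correlated. -/
lemma integral_inner_assign_nonpos (hd : M ∣ n) {h : Fin n → Vec d} (h0 : ∑ i, h i = 0)
    {q q' : Fin M × Fin (n / M)} (hq : q ≠ q') :
    ∫ ω : Sample d n M Ξ, inner ℝ (h (ω.assign q)) (h (ω.assign q')) ∂(law d n M ν) ≤ 0 := by
  have hm (r : Fin M × Fin (n / M)) : Measurable fun ω : Sample d n M Ξ => h (ω.assign r) :=
    (measurable_from_top (f := fun β : Assignment n M => h (β r))).comp Setup.measurable_assign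
  have hb (r : Fin M × Fin (n / M)) (ω : Sample d n M Ξ) : ‖h (ω.assign r)‖ ≤ ∑ i, ‖h i‖ :=
    Finset.single_le_sum (f := fun i => ‖h i‖) (fun i _ => norm_nonneg _) (Finset.mem_univ _)
  set J : Fin M × Fin (n / M) → ℝ := fun r =>
    ∫ ω : Sample d n M Ξ, inner ℝ (h (ω.assign q)) (h (ω.assign r)) ∂(law d n M ν) with hJ
  -- Exchangeability makes all off-diagonal correlations equal. They sum to minus the diagonal one,
  -- which is nonnegative, because the values of `h` sum to zero.
  have hsymm : ∀ r ∈ Finset.univ.erase q, J r = J q' := by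
    intro r hr
    rw [hJ]
    simp only
    rw [← integral_permute hd (Equiv.swap q' r) (measurable_inner_assign h q (hm r))]
    refine integral_congr_ae (Filter.Eventually.of_forall fun ω => ?_)
    simp only [permute, Sample.assign, Equiv.trans_apply, Equiv.swap_apply_right]
    rw [Equiv.swap_apply_of_ne_of_ne hq (Finset.ne_of_mem_erase hr).symm]
  have hsum : ∑ r, J r = 0 := by
    rw [hJ, ← integral_finsetSum _ fun r _ => integrable_inner_assign hd h q (hm r) (hb r)]
    refine integral_eq_zero_of_ae (Filter.Eventually.of_forall fun ω => ?_)
    simp only [Pi.zero_apply]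
    rw [← inner_sum, Equiv.sum_comp ω.assign h, h0, inner_zero_right]
  rw [← Finset.add_sum_erase _ _ (Finset.mem_univ q), Finset.sum_congr rfl hsymm,
    Finset.sum_const, nsmul_eq_mul] at hsum
  have hJq : 0 ≤ J q := integral_nonneg fun ω => real_inner_self_nonneg
  have hcard : (0 : ℝ) < ((Finset.univ.erase q).card : ℝ) := by
    exact_mod_cast Finset.card_pos.2 ⟨q', Finset.mem_erase.2 ⟨hq.symm, Finset.mem_univ _⟩⟩
  change J q' ≤ 0
  by_contra hc
  have := mul_pos hcard (not_le.1 hc)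
  linarith

/-- The second moment of a sum over a sample drawn without replacement. -/
lemma integral_norm_sum_assign_sq_le (hd : M ∣ n) {h : Fin n → Vec d} (h0 : ∑ i, h i = 0) {K : ℝ}
    (hK : ∀ i, ‖h i‖ ≤ K) (m : Fin M) (V : Finset (Fin (n / M))) :
    ∫ ω : Sample d n M Ξ, ‖∑ k ∈ V, h (ω.assign (m, k))‖ ^ 2 ∂(law d n M ν) ≤ V.card * K ^ 2 := by
  have := isProbabilityMeasure_law (d := d) ν hd
  have hm (r : Fin M × Fin (n / M)) : Measurable fun ω : Sample d n M Ξ => h (ω.assign r) :=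
    (measurable_from_top (f := fun β : Assignment n M => h (β r))).comp Setup.measurable_assign
  have hint (r r' : Fin M × Fin (n / M)) : Integrable (fun ω : Sample d n M Ξ =>
      (inner ℝ (h (ω.assign r)) (h (ω.assign r')) : ℝ)) (law d n M ν) :=
    integrable_inner_assign hd h r (hm r') fun ω => hK _
  have e (ω : Sample d n M Ξ) : ‖∑ k ∈ V, h (ω.assign (m, k))‖ ^ 2
      = ∑ k ∈ V, ∑ k' ∈ V, inner ℝ (h (ω.assign (m, k))) (h (ω.assign (m, k'))) := by
    rw [← real_inner_self_eq_norm_sq, sum_inner]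
    simp_rw [inner_sum]
  simp_rw [e]
  rw [integral_finsetSum _ fun k _ => integrable_finsetSum _ fun k' _ => hint _ _]
  refine (Finset.sum_le_card_nsmul V _ (K ^ 2) fun k hk => ?_).trans_eq (nsmul_eq_mul _ _)
  rw [integral_finsetSum _ fun k' _ => hint _ _, ← Finset.add_sum_erase _ _ hk]
  have h1 : ∑ k' ∈ V.erase k, ∫ ω : Sample d n M Ξ,
      inner ℝ (h (ω.assign (m, k))) (h (ω.assign (m, k'))) ∂(law d n M ν) ≤ 0 := by
    refine Finset.sum_nonpos fun k' hk' => integral_inner_assign_nonpos hd h0 fun he => ?_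
    exact Finset.ne_of_mem_erase hk' (Prod.ext_iff.1 he).2.symm
  have h2 : ∫ ω : Sample d n M Ξ, inner ℝ (h (ω.assign (m, k))) (h (ω.assign (m, k)))
      ∂(law d n M ν) ≤ ∫ _ : Sample d n M Ξ, K ^ 2 ∂(law d n M ν) := by
    refine integral_mono (hint _ _) (integrable_const _) fun ω => ?_
    simp only [real_inner_self_eq_norm_sq]
    have := hK (ω.assign (m, k))
    gcongr
  rw [integral_const, probReal_univ, one_smul] at h2
  linarith

/-- A random vector that does not depend on the samples at the positions in `V` has the same
expected inner product with the average over any nonempty subset of `V`. -/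
lemma integral_inner_average_eq (hd : M ∣ n) (h : Fin n → Vec d) (m : Fin M)
    {U V : Finset (Fin (n / M))} (hUV : U ⊆ V) (hU : U.Nonempty)
    {X : Sample d n M Ξ → Vec d} (hX : Measurable X) {K : ℝ} (hK : ∀ ω, ‖X ω‖ ≤ K)
    (hinv : ∀ k ∈ V, ∀ k' ∈ V, ∀ ω, X (permute (Equiv.swap (m, k) (m, k')) ω) = X ω) :
    ∫ ω, inner ℝ ((1 / (U.card : ℝ)) • ∑ k ∈ U, h (ω.assign (m, k))) (X ω) ∂(law d n M ν)
      = ∫ ω, inner ℝ ((1 / (V.card : ℝ)) • ∑ k ∈ V, h (ω.assign (m, k))) (X ω) ∂(law d n M ν) := by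
  obtain ⟨k₀, hk₀⟩ := hU
  set c := ∫ ω, inner ℝ (h (ω.assign (m, k₀))) (X ω) ∂(law d n M ν) with hc
  -- Swapping the positions `k` and `k₀` preserves the law and `X`, so all positions in `V`
  -- contribute equally to any average.
  have heq : ∀ k ∈ V, ∫ ω, inner ℝ (h (ω.assign (m, k))) (X ω) ∂(law d n M ν) = c := by
    intro k hk
    rw [hc, ← integral_permute hd (Equiv.swap (m, k) (m, k₀))
      (measurable_inner_assign h (m, k) hX)]
    refine integral_congr_ae (Filter.Eventually.of_forall fun ω => ?_)
    simp only
    rw [hinv k hk k₀ (hUV hk₀)]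
    simp [permute, Sample.assign]
  have hgen : ∀ A : Finset (Fin (n / M)), A ⊆ V → k₀ ∈ A →
      ∫ ω, inner ℝ ((1 / (A.card : ℝ)) • ∑ k ∈ A, h (ω.assign (m, k))) (X ω) ∂(law d n M ν)
        = c := by
    intro A hA hk
    have hcard : (A.card : ℝ) ≠ 0 := by exact_mod_cast Finset.card_ne_zero_of_mem hk
    simp_rw [real_inner_smul_left, sum_inner]
    rw [integral_const_mul, integral_finsetSum _ fun k _ => integrable_inner_assign hd h _ hX hK,
      Finset.sum_congr rfl fun k hk => heq k (hA hk), Finset.sum_const, nsmul_eq_mul]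
    field_simp
  rw [hgen U hUV hk₀, hgen V subset_rfl (hUV hk₀)]

end Sampling


/-! ### Expected effect of one update -/

namespace Setup

variable {d n M : ℕ} {S : Setup d n M} {B : ℝ} {T : ℕ} {Ξ : Type} [MeasurableSpace Ξ]
  {ν : Measure Ξ} [IsProbabilityMeasure ν] {p : ℕ → Fin M → Sample d n M Ξ → ℝ}

lemma integrable_of_bounded (hd : M ∣ n) {H : Sample d n M Ξ → ℝ} (hH : Measurable H) {K : ℝ}
    (hK : ∀ ω, |H ω| ≤ K) : Integrable H (law d n M ν) := by
  have := isProbabilityMeasure_law (d := d) ν hd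
  exact Integrable.of_bound hH.aestronglyMeasurable K (Filter.Eventually.of_forall hK)

section Resample

variable (t : ℕ) (j : Fin M) (ω : Sample d n M Ξ) (ζ : ℝ × Vec d)

omit [MeasurableSpace Ξ] in
lemma agreeAt_resample_of_ne {s t : ℕ} {m m' : Fin M} (h : (s, m') ≠ (t, m)) :
    S.AgreeAt s m' (resample (t, m) ω ζ) ω := by
  refine ⟨fun k _ => rfl, ?_, ?_⟩ <;>
    simp [Sample.coin, Sample.gauss, resample, Function.update_of_ne h]

/-- The coin and the noise of an update are not used before that update. So, given everything else,
the current state and the probability are constants in the integral over this pair. -/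
lemma stage_resample (hp : S.IsController p) :
    S.stage p (resample (t + 1, S.order (t + 1) j) ω ζ) t j = S.stage p ω t j := by
  refine stage_congr hp (by rfl) t j j.2.le fun s m _ hd => agreeAt_resample_of_ne ω ζ fun he => ?_
  obtain ⟨rfl, rfl⟩ := Prod.ext_iff.1 he
  rcases hd with hd | ⟨-, hd⟩
  · simp at hd
  · simp at hd

lemma controller_resample (hp : S.IsController p) :
    p (t + 1) (S.order (t + 1) j) (resample (t + 1, S.order (t + 1) j) ω ζ)
      = p (t + 1) (S.order (t + 1) j) ω := by
  refine (hp _ _).2 _ _ ⟨rfl, fun s m _ hb => agreeAt_resample_of_ne ω ζ fun he => ?_,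
    fun k _ => rfl⟩
  obtain ⟨rfl, rfl⟩ := Prod.ext_iff.1 he
  rcases hb with hb | ⟨-, hb⟩
  · simp at hb
  · simp at hb

omit [MeasurableSpace Ξ] in
lemma coin_resample {t : ℕ} {m : Fin M} : (resample (t, m) ω ζ).coin t m = ζ.1 := by
  simp [Sample.coin, resample]

omit [MeasurableSpace Ξ] in
lemma gauss_resample {t : ℕ} {m : Fin M} : (resample (t, m) ω ζ).gauss t m = ζ.2 := by
  simp [Sample.gauss, resample]

end Resample

lemma measurable_resample (e : ℕ × Fin M) (ω : Sample d n M Ξ) :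
    Measurable (resample e ω) := by
  have hm : Measurable fun ζ : ℝ × Vec d => Function.update ω.2.2 e ζ := measurable_update _
  exact measurable_const.prodMk (measurable_const.prodMk hm)

lemma abs_one_div_succ_sq_le (r : ℕ) : |1 / ((r : ℝ) + 1) ^ 2| ≤ 1 := by
  rw [abs_of_nonneg (by positivity), div_le_one (by positivity)]
  have : (0 : ℝ) ≤ r := r.cast_nonneg
  nlinarith

lemma Regular.integrable_last (hS : S.Regular B T) (hp : S.IsController p) (t k : ℕ) (hk : k ≤ M)
    (m : Fin M) :
    Integrable (fun ω => 1 / (((S.stage p ω t k).last m : ℝ) + 1) ^ 2) (law d n M ν) :=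
  integrable_of_bounded hS.dvd ((measurable_from_top (f := fun r : ℕ => 1 / ((r : ℝ) + 1) ^ 2)).comp
    ((hS.measurableState_stage hp t k hk).2.2 m)) fun _ => abs_one_div_succ_sq_le _

lemma Regular.integrable_loc (hS : S.Regular B T) (hp : S.IsController p) {wStar : Vec d}
    (hw : wStar ∈ S.W) (t k : ℕ) (hk : k ≤ M) (m : Fin M) :
    Integrable (fun ω => ‖(S.stage p ω t k).loc m - wStar‖ ^ 2) (law d n M ν) :=
  integrable_of_bounded hS.dvd
    ((((hS.measurableState_stage hp t k hk).1 m).sub_const wStar).norm.pow_const 2) fun ω => by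
      rw [abs_of_nonneg (by positivity)]
      exact hS.norm_sub_sq_le ((hS.stage_mem ω t k hk).1 m) hw

lemma Regular.integrable_glob (hS : S.Regular B T) (hp : S.IsController p) {wStar : Vec d}
    (hw : wStar ∈ S.W) (t k : ℕ) (hk : k ≤ M) :
    Integrable (fun ω => ‖(S.stage p ω t k).glob - wStar‖ ^ 2) (law d n M ν) :=
  integrable_of_bounded hS.dvd
    (((hS.measurableState_stage hp t k hk).2.1.sub_const wStar).norm.pow_const 2) fun ω => by
      rw [abs_of_nonneg (by positivity)]
      exact hS.norm_sub_sq_le (hS.stage_mem ω t k hk).2 hw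

lemma Regular.integrable_inner_batchGrad (hS : S.Regular B T) (hp : S.IsController p)
    {wStar : Vec d} (hw : wStar ∈ S.W) {t : ℕ} (ht : t + 1 ≤ T) (k : ℕ) (hk : k ≤ M)
    (m : Fin M) :
    Integrable (fun ω => (inner ℝ (S.batchGrad ω.assign (t + 1) m wStar)
      ((S.stage p ω t k).loc m - wStar) : ℝ)) (law d n M ν) := by
  refine integrable_of_bounded hS.dvd (Measurable.inner (measurable_batchGrad measurable_assign
    measurable_const _ _) (((hS.measurableState_stage hp t k hk).1 m).sub_const wStar))
    (K := B * (2 * B / S.γ)) fun ω => ?_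
  exact (abs_real_inner_le_norm _ _).trans (mul_le_mul (hS.norm_batchGrad_le _ ht m hw)
    (hS.norm_sub_le ((hS.stage_mem ω t k hk).1 m) hw) (norm_nonneg _) hS.B_nonneg)

namespace Regular

variable (hS : S.Regular B T) (hp : S.IsController p)
include hS hp

/-- The expected change in one node update, before averaging over the mini-batch. -/
lemma integral_update_le
    (hpa : ∀ t m ω, 1 ≤ t → t ≤ T → S.a ≤ p t m ω ∧ S.a ≤ 1 - p t m ω) {wStar : Vec d}
    (hw : wStar ∈ S.W) {t : ℕ} (ht : t + 1 ≤ T) (j : Fin M) :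
    ∫ ω, (‖(S.stage p ω t (j + 1)).loc (S.order (t + 1) j) - wStar‖ ^ 2
        + ‖(S.stage p ω t (j + 1)).glob - wStar‖ ^ 2) ∂(law d n M ν)
      ≤ ∫ ω, (‖(S.stage p ω t j).loc (S.order (t + 1) j) - wStar‖ ^ 2
          + ‖(S.stage p ω t j).glob - wStar‖ ^ 2
          - 4 / ((t : ℝ) + 1) * (‖(S.stage p ω t j).loc (S.order (t + 1) j) - wStar‖ ^ 2
            + ‖(S.stage p ω t j).glob - wStar‖ ^ 2)
          - 4 * S.stepSize (t + 1) * inner ℝ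
            (S.batchGrad ω.assign (t + 1) (S.order (t + 1) j) wStar)
            ((S.stage p ω t j).loc (S.order (t + 1) j) - wStar)
          + 20 * S.stepSize (t + 1) ^ 2 * B ^ 2
          + 2 * d * (8 * S.L ^ 2 * Real.log (1.25 / S.δ) /
            (S.a ^ 2 * S.γ ^ 2 * (S.b : ℝ) ^ 2 * S.ε ^ 2)
              * (1 / (((S.stage p ω t j).last (S.order (t + 1) j) : ℝ) + 1) ^ 2)))
        ∂(law d n M ν) := by
  have hη := hS.stepSize_pos (t := t + 1) (by omega)
  set m := S.order (t + 1) j with hm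
  set η := S.stepSize (t + 1) with hηdef
  have hW := hS.stage_mem (p := p)
  have hms := hS.measurableState_stage hp t j j.2.le
  have hms' := hS.measurableState_stage hp t (j + 1) j.2
  have hHm : Measurable fun ω => ‖(S.stage p ω t (j + 1)).loc m - wStar‖ ^ 2
      + ‖(S.stage p ω t (j + 1)).glob - wStar‖ ^ 2 :=
    (((hms'.1 m).sub_const wStar).norm.pow_const 2).add
      ((hms'.2.1.sub_const wStar).norm.pow_const 2)
  have hHb : ∀ ω, |‖(S.stage p ω t (j + 1)).loc m - wStar‖ ^ 2
      + ‖(S.stage p ω t (j + 1)).glob - wStar‖ ^ 2| ≤ 2 * (2 * B / S.γ) ^ 2 := by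
    intro ω
    have h1 := hS.norm_sub_sq_le ((hW ω t (j + 1) j.2).1 m) hw
    have h2 := hS.norm_sub_sq_le (hW ω t (j + 1) j.2).2 hw
    rw [abs_of_nonneg (by positivity)]
    linarith
  refine integral_le_of_resample hS.dvd (t + 1, m) hHm hHb ?_ fun ω => ?_
  · have i1 := hS.integrable_loc hp hw (ν := ν) t j j.2.le m
    have i2 := hS.integrable_glob hp hw (ν := ν) t j j.2.le
    have i3 := hS.integrable_inner_batchGrad hp (ν := ν) hw ht j j.2.le m
    have i4 := hS.integrable_last hp (ν := ν) t j j.2.le m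
    have := isProbabilityMeasure_law (d := d) ν hS.dvd
    exact ((((i1.add i2).sub ((i1.add i2).const_mul _)).sub (i3.const_mul _)).add
      (integrable_const _)).add ((i4.const_mul _).const_mul _)
  obtain ⟨hp1, hp2⟩ := hpa (t + 1) m ω (by omega) ht
  have ha := hS.a_pos
  obtain ⟨hxW, hyW⟩ := hW ω t j j.2.le
  have hxW := hxW m
  set x := S.stage p ω t j with hx
  set q := p (t + 1) m ω with hq
  set σ := S.noiseStd (x.last m + 1) (t + 1) with hσ
  set c : Vec d := (1 / 2 : ℝ) • ((x.loc m - wStar) + (x.glob - wStar))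
    - η • S.batchGrad ω.assign (t + 1) m x.glob with hc
  -- Projection only brings points closer to `wStar`. A global update gives both models the same
  -- value, hence the factor 2.
  have hcond : ∀ ζ, ‖(S.stage p (resample (t + 1, m) ω ζ) t (j + 1)).loc m - wStar‖ ^ 2
      + ‖(S.stage p (resample (t + 1, m) ω ζ) t (j + 1)).glob - wStar‖ ^ 2
      ≤ if ζ.1 < q then
          ‖(x.loc m - wStar) - (2 * η) • S.batchGrad ω.assign (t + 1) m (x.loc m)‖ ^ 2
            + ‖x.glob - wStar‖ ^ 2
        else 2 * ‖c - σ • ζ.2‖ ^ 2 := by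
    intro ζ
    have h1 : (resample (t + 1, m) ω ζ).assign = ω.assign := rfl
    rw [stage_succ, nodeUpdate_loc_self, nodeUpdate_glob, stage_resample t j ω ζ hp,
      controller_resample t j ω ζ hp, coin_resample, gauss_resample, h1]
    split_ifs
    · have h2 := norm_proj_sub_le hS.isClosed hS.convex
        (x.loc m - (2 * η) • S.batchGrad ω.assign (t + 1) m (x.loc m)) hw
      rw [sub_right_comm] at h2
      gcongr
    · have h2 := norm_proj_sub_le hS.isClosed hS.convex
        ((1 / 2 : ℝ) • (x.glob + x.loc m) - η •
          (S.batchGrad ω.assign (t + 1) m x.glob + (σ / η) • ζ.2)) hw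
      have h3 : (1 / 2 : ℝ) • (x.glob + x.loc m) - η •
          (S.batchGrad ω.assign (t + 1) m x.glob + (σ / η) • ζ.2) - wStar = c - σ • ζ.2 := by
        rw [hc, smul_add η, smul_smul, mul_div_cancel₀ _ hη.ne']
        module
      rw [h3] at h2
      rw [two_mul]
      gcongr
  refine (integral_ite_le (ha.le.trans hp1) (by linarith) _
    ((integrable_norm_sub_smul_sq_stdGaussian c σ).const_mul 2) ?_ hcond).trans ?_
  · refine Integrable.of_bound (hHm.comp (measurable_resample _ ω)).aestronglyMeasurable
      (2 * (2 * B / S.γ) ^ 2) (Filter.Eventually.of_forall fun ζ => hHb _)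
  rw [integral_const_mul, integral_norm_sub_smul_sq_stdGaussian]
  have hone := one_step_le (t := (t : ℝ) + 1) hS.γ_pos ha (by positivity)
    (η := η) (by rw [hηdef, stepSize]; push_cast; rfl) hp1 hp2
    (hS.inner_batchGrad_sub ω.assign ht m hxW hw) (hS.inner_batchGrad_sub ω.assign ht m hyW hw)
    (hS.norm_batchGrad_le ω.assign ht m hxW) (hS.norm_batchGrad_le ω.assign ht m hyW)
    (hS.norm_batchGrad_le ω.assign ht m hw)
  have hnoise := hS.noiseStd_sq_le (Nat.le_add_left 1 (x.last m)) (t + 1)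
  rw [← hσ] at hnoise
  push_cast at hnoise
  -- The probability of the noisy branch is simply bounded by 1.
  have h1 : (1 - q) * (2 * (d * σ ^ 2)) ≤ 2 * d * σ ^ 2 := by
    have : 0 ≤ q * (2 * (d * σ ^ 2)) := by
      have : 0 ≤ q := ha.le.trans hp1
      positivity
    linarith
  have h2 := mul_le_mul_of_nonneg_left hnoise (by positivity : (0 : ℝ) ≤ 2 * d)
  rw [mul_add 2, mul_add (1 - q)]
  linarith

/-- The expected change of the noise level in one node update. -/
lemma integral_last_le
    (hpa : ∀ t m ω, 1 ≤ t → t ≤ T → S.a ≤ p t m ω ∧ S.a ≤ 1 - p t m ω)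
    {t : ℕ} (ht : t + 1 ≤ T) (j : Fin M) :
    ∫ ω, 1 / (((S.stage p ω t (j + 1)).last (S.order (t + 1) j) : ℝ) + 1) ^ 2 ∂(law d n M ν)
      ≤ (1 - S.a) *
        ∫ ω, 1 / (((S.stage p ω t j).last (S.order (t + 1) j) : ℝ) + 1) ^ 2 ∂(law d n M ν)
        + S.a / ((t : ℝ) + 2) ^ 2 := by
  set m := S.order (t + 1) j with hm
  have hms' := hS.measurableState_stage hp t (j + 1) j.2
  have hHm : Measurable fun ω => 1 / (((S.stage p ω t (j + 1)).last m : ℝ) + 1) ^ 2 :=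
    (measurable_from_top (f := fun r : ℕ => 1 / ((r : ℝ) + 1) ^ 2)).comp (hms'.2.2 m)
  have hHb : ∀ ω, |1 / (((S.stage p ω t (j + 1)).last m : ℝ) + 1) ^ 2| ≤ 1 := fun ω =>
    abs_one_div_succ_sq_le _
  have := isProbabilityMeasure_law (d := d) ν hS.dvd
  have hi := hS.integrable_last hp (ν := ν) t j j.2.le m
  have e : (1 - S.a) * ∫ ω, 1 / (((S.stage p ω t j).last m : ℝ) + 1) ^ 2 ∂(law d n M ν)
      + S.a / ((t : ℝ) + 2) ^ 2
      = ∫ ω, ((1 - S.a) * (1 / (((S.stage p ω t j).last m : ℝ) + 1) ^ 2)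
        + S.a / ((t : ℝ) + 2) ^ 2) ∂(law d n M ν) := by
    rw [integral_add (hi.const_mul _) (integrable_const _), integral_const_mul]
    simp
  rw [e]
  refine integral_le_of_resample hS.dvd (t + 1, m) hHm hHb
    ((hi.const_mul _).add (integrable_const _)) fun ω => ?_
  obtain ⟨hp1, hp2⟩ := hpa (t + 1) m ω (by omega) ht
  have ha := hS.a_pos
  have hlast : (((S.stage p ω t j).last m : ℕ) : ℝ) ≤ (t : ℝ) + 1 := by
    exact_mod_cast stage_last_le ω t j j.2.le m
  set x := S.stage p ω t j with hx
  set q := p (t + 1) m ω with hq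
  have hcond : ∀ ζ, 1 / (((S.stage p (resample (t + 1, m) ω ζ) t (j + 1)).last m : ℝ) + 1) ^ 2
      ≤ if ζ.1 < q then 1 / ((x.last m : ℝ) + 1) ^ 2 else 1 / ((t : ℝ) + 2) ^ 2 := by
    intro ζ
    rw [stage_succ, nodeUpdate_last_self, stage_resample t j ω ζ hp,
      controller_resample t j ω ζ hp, coin_resample]
    split_ifs
    · exact le_rfl
    · push_cast
      rw [add_assoc, one_add_one_eq_two]
  refine (integral_ite_le (ha.le.trans hp1) (by linarith) _
    (integrable_const (1 / ((t : ℝ) + 2) ^ 2)) ?_ hcond).trans ?_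
  · exact Integrable.of_bound (hHm.comp (measurable_resample _ ω)).aestronglyMeasurable
      1 (Filter.Eventually.of_forall fun ζ => hHb _)
  rw [integral_const, probReal_univ, one_smul]
  -- A global update can only lower this quantity, so the worst case is the smallest probability
  -- `S.a` of making one.
  have h1 : 1 / ((t : ℝ) + 2) ^ 2 ≤ 1 / ((x.last m : ℝ) + 1) ^ 2 := by
    have : (x.last m : ℝ) + 1 ≤ (t : ℝ) + 2 := by linarith
    gcongr
  rw [div_eq_mul_one_div S.a]
  nlinarith

end Regular

end Setup


/-! ### Sampling bias, age of the last global update, and the error of one update -/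

namespace Setup

variable {d n M : ℕ} {S : Setup d n M} {B : ℝ} {T : ℕ} {Ξ : Type} [MeasurableSpace Ξ]
  {ν : Measure Ξ} [IsProbabilityMeasure ν] {p : ℕ → Fin M → Sample d n M Ξ → ℝ}

/-- The state in which a node acts does not depend on how the samples are arranged at the positions
from which this node has not drawn yet. -/
lemma stage_permute (hp : S.IsController p) (t : ℕ) (j : Fin M) {k k' : Fin (n / M)}
    (hk : k ∈ S.remaining t) (hk' : k' ∈ S.remaining t) (ω : Sample d n M Ξ) :
    S.stage p (permute (Equiv.swap (S.order (t + 1) j, k) (S.order (t + 1) j, k')) ω) t j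
      = S.stage p ω t j := by
  refine stage_congr hp (by rfl) t j j.2.le fun s m _ hd => ⟨fun i hi => ?_, rfl, rfl⟩
  have hne : ∀ l ∈ S.remaining t, (m, i) ≠ (S.order (t + 1) j, l) := by
    intro l hl he
    obtain ⟨rfl, rfl⟩ := Prod.mk.inj he
    rcases hd with hd | ⟨rfl, hd⟩
    · exact notMem_batch_of_mem_remaining hd hl hi
    · simp at hd
  simp only [permute, Sample.assign, Equiv.trans_apply]
  rw [Equiv.swap_apply_of_ne_of_ne (hne k hk) (hne k' hk')]

lemma measurable_sum_assign (h : Fin n → Vec d) (m : Fin M) (V : Finset (Fin (n / M))) :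
    Measurable fun ω : Sample d n M Ξ => ∑ k ∈ V, h (ω.assign (m, k)) :=
  Finset.measurable_fun_sum _ fun k _ =>
    (measurable_from_top (f := fun β : Assignment n M => h (β (m, k)))).comp measurable_assign

namespace Regular

variable (hS : S.Regular B T)
include hS

/-- The bias due to sampling without replacement. -/
lemma neg_integral_inner_batchGrad_le (hp : S.IsController p) {wStar : Vec d}
    (hw : wStar ∈ S.W)
    (hmin : ∀ w ∈ S.W, empiricalRisk S.f wStar ≤ empiricalRisk S.f w) {t : ℕ} (ht : t + 1 ≤ T)
    (j : Fin M) :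
    - (4 * S.stepSize (t + 1) * ∫ ω, inner ℝ
        (S.batchGrad ω.assign (t + 1) (S.order (t + 1) j) wStar)
        ((S.stage p ω t j).loc (S.order (t + 1) j) - wStar) ∂(law d n M ν))
      ≤ 2 / ((t : ℝ) + 1) *
          ∫ ω, ‖(S.stage p ω t j).loc (S.order (t + 1) j) - wStar‖ ^ 2 ∂(law d n M ν)
        + 8 * B ^ 2 / (S.a ^ 2 * S.γ ^ 2 * ((t : ℝ) + 1) * (S.b * ((T : ℝ) - t))) := by
  have hη := hS.stepSize_pos (t := t + 1) (by omega)
  have hη' : S.stepSize (t + 1) = 1 / (S.a * S.γ * ((t : ℝ) + 1)) := by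
    rw [stepSize]; push_cast; rfl
  set m := S.order (t + 1) j with hm
  set η := S.stepSize (t + 1) with hηdef
  have := isProbabilityMeasure_law (d := d) ν hS.dvd
  have hn : (0 : ℝ) < n := by exact_mod_cast hS.n_pos
  have hb : (0 : ℝ) < S.b := by exact_mod_cast hS.b_pos
  set X : Sample d n M Ξ → Vec d := fun ω => (S.stage p ω t j).loc m - wStar with hX
  have hXm : Measurable X := ((hS.measurableState_stage hp t j j.2.le).1 m).sub_const wStar
  have hXW : ∀ ω, (S.stage p ω t j).loc m ∈ S.W := fun ω => (hS.stage_mem ω t j j.2.le).1 m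
  have hXb : ∀ ω, ‖X ω‖ ≤ 2 * B / S.γ := fun ω => hS.norm_sub_le (hXW ω) hw
  set U := S.batch (n := n) (M := M) (t + 1) with hU
  set V := S.remaining (n := n) (M := M) t with hV
  have hUc : U.card = S.b := hS.card_batch ht
  have hUne : U.Nonempty := by
    rw [← Finset.card_pos, hUc]; exact hS.b_pos
  have hVc : (S.b : ℝ) * ((T : ℝ) - t) ≤ V.card := by
    have h := hS.le_card_remaining t
    have h' : (((T - t) * S.b : ℕ) : ℝ) ≤ V.card := by exact_mod_cast h
    rw [Nat.cast_mul, Nat.cast_sub (by omega)] at h'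
    linarith
  have hTt : (0 : ℝ) < (T : ℝ) - t := by
    rw [sub_pos]; exact_mod_cast ht
  have hV0 : (0 : ℝ) < V.card := (mul_pos hb hTt).trans_le hVc
  set g : Fin n → Vec d := fun i => gradient (S.f i) wStar with hg
  set gbar : Vec d := (1 / (n : ℝ)) • ∑ i, g i with hgbar
  set h : Fin n → Vec d := fun i => g i - gbar with hh
  have h0 : ∑ i, h i = 0 := by
    rw [hh, Finset.sum_sub_distrib, Finset.sum_const, Finset.card_univ, Fintype.card_fin, hgbar,
      ← Nat.cast_smul_eq_nsmul ℝ, smul_smul, mul_one_div_cancel hn.ne', one_smul, sub_self]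
  have hgb : ∀ i, ‖g i‖ ≤ B := fun i => hS.norm_gradient_le i _ hw
  have hgbarb : ‖gbar‖ ≤ B := by
    rw [hgbar, norm_smul, Real.norm_of_nonneg (by positivity), one_div, inv_mul_le_iff₀ hn]
    refine (norm_sum_le _ _).trans ((Finset.sum_le_card_nsmul _ _ B fun i _ => hgb i).trans_eq ?_)
    simp
  have hhb : ∀ i, ‖h i‖ ≤ 2 * B := fun i =>
    (_root_.norm_sub_le _ _).trans (by linarith [hgb i])
  -- Optimality controls only the full gradient `gbar`; the remainder is an average of vectors whose
  -- total over all samples is zero.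
  have hdec : ∀ ω : Sample d n M Ξ, S.batchGrad ω.assign (t + 1) m wStar
      = gbar + (1 / (U.card : ℝ)) • ∑ k ∈ U, h (ω.assign (m, k)) := by
    intro ω
    simp only [hh, Finset.sum_sub_distrib, Finset.sum_const, smul_sub]
    rw [← Nat.cast_smul_eq_nsmul ℝ, smul_smul, hUc, one_div_mul_cancel hb.ne', one_smul, batchGrad]
    abel
  have hopt : ∀ ω, 0 ≤ (inner ℝ gbar (X ω) : ℝ) := by
    intro ω
    rw [hgbar, real_inner_smul_left]
    have := inner_sum_gradient_nonneg hS.convex (fun i => (hS.stronglyConvex i).1 _ hw) hS.n_pos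
      hw hmin (hXW ω)
    positivity
  have hXi : Integrable X (law d n M ν) :=
    Integrable.of_bound hXm.aestronglyMeasurable _ (Filter.Eventually.of_forall hXb)
  set Z : Sample d n M Ξ → Vec d := fun ω => (1 / (V.card : ℝ)) • ∑ k ∈ V, h (ω.assign (m, k))
    with hZ
  have hZm : Measurable Z := (measurable_sum_assign h m V).const_smul (1 / (V.card : ℝ))
  have hZb : ∀ ω, ‖Z ω‖ ≤ 2 * B := by
    intro ω
    rw [hZ]
    simp only
    rw [norm_smul, Real.norm_of_nonneg (by positivity), one_div, inv_mul_le_iff₀ hV0]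
    refine (norm_sum_le _ _).trans ((Finset.sum_le_card_nsmul _ _ (2 * B)
      fun i _ => hhb _).trans_eq ?_)
    simp
  have iU : Integrable (fun ω => (inner ℝ ((1 / (U.card : ℝ)) • ∑ k ∈ U, h (ω.assign (m, k)))
      (X ω) : ℝ)) (law d n M ν) := by
    simp_rw [real_inner_smul_left, sum_inner]
    exact (integrable_finsetSum _ fun k _ =>
      integrable_inner_assign hS.dvd h _ hXm hXb).const_mul _
  have iX : Integrable (fun ω => ‖X ω‖ ^ 2) (law d n M ν) := hS.integrable_loc hp hw t j j.2.le m
  have iZ : Integrable (fun ω => ‖Z ω‖ ^ 2) (law d n M ν) :=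
    integrable_of_bounded hS.dvd (hZm.norm.pow_const 2) (K := (2 * B) ^ 2) fun ω => by
      have := hZb ω
      rw [abs_of_nonneg (by positivity)]
      gcongr
  have iZX : Integrable (fun ω => (inner ℝ (Z ω) (X ω) : ℝ)) (law d n M ν) :=
    integrable_of_bounded hS.dvd (hZm.inner hXm) (K := 2 * B * (2 * B / S.γ)) fun ω =>
      (abs_real_inner_le_norm _ _).trans (mul_le_mul (hZb ω) (hXb ω) (norm_nonneg _)
        (by linarith [hS.B_nonneg]))
  -- The mini-batch average is exchanged for the average `Z` over all remaining positions, whose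
  -- second moment is smaller. The `gbar` part is nonnegative and is dropped.
  have hsplit : ∫ ω, (inner ℝ (Z ω) (X ω) : ℝ) ∂(law d n M ν)
      ≤ ∫ ω, (inner ℝ (S.batchGrad ω.assign (t + 1) m wStar) (X ω) : ℝ) ∂(law d n M ν) := by
    rw [← integral_inner_average_eq hS.dvd h m (batch_succ_subset_remaining t) hUne hXm hXb
      fun k hk k' hk' ω => by rw [hX]; simp only; rw [stage_permute hp t j hk hk' ω]]
    simp_rw [hdec, inner_add_left]
    rw [integral_add (hXi.const_inner gbar) iU]
    have : 0 ≤ ∫ ω, (inner ℝ gbar (X ω) : ℝ) ∂(law d n M ν) := integral_nonneg fun ω => hopt ω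
    linarith
  have hZ2 : ∫ ω, ‖Z ω‖ ^ 2 ∂(law d n M ν) ≤ 4 * B ^ 2 / (S.b * ((T : ℝ) - t)) := by
    have h1 := integral_norm_sum_assign_sq_le (d := d) (ν := ν) hS.dvd h0 hhb m V
    have e : ∀ ω, ‖Z ω‖ ^ 2
        = (1 / (V.card : ℝ)) ^ 2 * ‖∑ k ∈ V, h (ω.assign (m, k))‖ ^ 2 := by
      intro ω
      rw [hZ]
      simp only
      rw [norm_smul, mul_pow, Real.norm_of_nonneg (by positivity)]
    simp_rw [e]
    rw [integral_const_mul]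
    calc _ ≤ (1 / (V.card : ℝ)) ^ 2 * (V.card * (2 * B) ^ 2) := by gcongr
      _ = 4 * B ^ 2 / V.card := by field_simp; ring
      _ ≤ _ := by
        have := mul_pos hb hTt
        gcongr
  -- Young's inequality, weighted so that `X` costs 2/(t + 1), half of the available contraction
  -- rate 4/(t + 1).
  have hpt : ∫ ω, - (4 * η * (inner ℝ (Z ω) (X ω) : ℝ)) ∂(law d n M ν)
      ≤ ∫ ω, (2 / ((t : ℝ) + 1) * ‖X ω‖ ^ 2 + 2 * ((t : ℝ) + 1) * η ^ 2 * ‖Z ω‖ ^ 2)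
        ∂(law d n M ν) := by
    refine integral_mono ((iZX.const_mul _).neg) ((iX.const_mul _).add (iZ.const_mul _)) fun ω => ?_
    have h1 := (abs_le.1 (abs_real_inner_le_norm (Z ω) (X ω))).1
    have h2 : 2 / ((t : ℝ) + 1) * ‖X ω‖ ^ 2 + 2 * ((t : ℝ) + 1) * η ^ 2 * ‖Z ω‖ ^ 2
        - 4 * η * (‖Z ω‖ * ‖X ω‖)
        = 2 / ((t : ℝ) + 1) * (‖X ω‖ - ((t : ℝ) + 1) * η * ‖Z ω‖) ^ 2 := by
      field_simp
      ring
    have h3 : 0 ≤ 2 / ((t : ℝ) + 1) * (‖X ω‖ - ((t : ℝ) + 1) * η * ‖Z ω‖) ^ 2 := by positivity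
    have h4 := mul_le_mul_of_nonneg_left h1 (by positivity : 0 ≤ 4 * η)
    simp only
    linarith
  rw [integral_neg, integral_const_mul, integral_add (iX.const_mul _) (iZ.const_mul _),
    integral_const_mul, integral_const_mul] at hpt
  have h5 := mul_le_mul_of_nonneg_left hsplit (by positivity : 0 ≤ 4 * η)
  have h6 := mul_le_mul_of_nonneg_left hZ2 (by positivity : 0 ≤ 2 * ((t : ℝ) + 1) * η ^ 2)
  have h7 : 2 * ((t : ℝ) + 1) * η ^ 2 * (4 * B ^ 2 / (S.b * ((T : ℝ) - t)))
      = 8 * B ^ 2 / (S.a ^ 2 * S.γ ^ 2 * ((t : ℝ) + 1) * (S.b * ((T : ℝ) - t))) := by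
    have := hS.a_pos.ne'
    have := hS.γ_pos.ne'
    rw [hη']
    field_simp
    ring
  linarith

/-- Once `a² t ≥ 1`, the last global update of a node is typically not much older than `t`. -/
lemma integral_inv_last_le (hp : S.IsController p)
    (hpa : ∀ t m ω, 1 ≤ t → t ≤ T → S.a ≤ p t m ω ∧ S.a ≤ 1 - p t m ω)
    {t : ℕ} (ht : t + 1 ≤ T) (hat : 1 ≤ S.a ^ 2 * ((t : ℝ) + 1)) (m : Fin M) :
    ∫ ω, 1 / (((S.run p ω t).last m : ℝ) + 1) ^ 2 ∂(law d n M ν) ≤ 258 / ((t : ℝ) + 1) ^ 2 := by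
  have hprob := isProbabilityMeasure_law (d := d) ν hS.dvd
  have ha := hS.a_pos
  obtain ⟨ω₀⟩ : Nonempty (Sample d n M Ξ) := nonempty_of_isProbabilityMeasure (law d n M ν)
  have ha1 : S.a ≤ 1 := by
    have := hpa (t + 1) m ω₀ (by omega) ht
    linarith
  have h1 : ∀ s, ∫ ω, 1 / (((S.run p ω s).last m : ℝ) + 1) ^ 2 ∂(law d n M ν) ≤ 1 := by
    intro s
    have := integral_mono (hS.integrable_last hp (ν := ν) s 0 (Nat.zero_le _) m)
      (integrable_const (1 : ℝ)) fun ω => (abs_le.1 (abs_one_div_succ_sq_le _)).2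
    rwa [integral_const, probReal_univ, one_smul] at this
  have hu : ∀ s, s + 1 ≤ T →
      ∫ ω, 1 / (((S.run p ω (s + 1)).last m : ℝ) + 1) ^ 2 ∂(law d n M ν)
        ≤ (1 - S.a) * ∫ ω, 1 / (((S.run p ω s).last m : ℝ) + 1) ^ 2 ∂(law d n M ν)
          + S.a / ((s : ℝ) + 2) ^ 2 := by
    intro s hs
    obtain ⟨j, rfl⟩ := (S.order (s + 1)).surjective m
    have h := hS.integral_last_le hp (ν := ν) hpa hs j
    have e1 : ∀ ω, (S.run p ω (s + 1)).last (S.order (s + 1) j)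
        = (S.stage p ω s (j + 1)).last (S.order (s + 1) j) := fun ω => by
      rw [run_succ]
      exact (stage_eq_of_le ω s j.2 le_rfl j (Or.inl (Nat.lt_succ_self _))).2
    have e2 : ∀ ω, (S.stage p ω s j).last (S.order (s + 1) j)
        = (S.run p ω s).last (S.order (s + 1) j) := fun ω =>
      (stage_eq_of_le ω s (Nat.zero_le _) j.2.le j (Or.inr le_rfl)).2
    simp_rw [e1, ← e2]
    exact h
  refine (relaxation_le ha h1 hu ha1 (Nat.le_of_succ_le ht)).trans ?_
  have ht0 : (0 : ℝ) < (t : ℝ) + 1 := by positivity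
  -- Here a²(t + 1) ≥ 1 removes `a` from the transient term, and 258 = 2 + 256.
  have h2 : ((t : ℝ) + 1) ^ 2 ≤ S.a ^ 4 * ((t : ℝ) + 1) ^ 4 := by
    calc ((t : ℝ) + 1) ^ 2 = 1 ^ 2 * ((t : ℝ) + 1) ^ 2 := by ring
      _ ≤ (S.a ^ 2 * ((t : ℝ) + 1)) ^ 2 * ((t : ℝ) + 1) ^ 2 := by gcongr
      _ = _ := by ring
  have h3 : 256 / (S.a ^ 4 * ((t : ℝ) + 1) ^ 4) ≤ 256 / ((t : ℝ) + 1) ^ 2 := by gcongr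
  have h4 : 2 / ((t : ℝ) + 1) ^ 2 + 256 / ((t : ℝ) + 1) ^ 2 = 258 / ((t : ℝ) + 1) ^ 2 := by
    rw [← add_div]; norm_num
  linarith

end Regular

/-- Linearity in abstract variables, shaped like the integrand on the right of `integral_update_le`.
-/
lemma integral_bound_eq {Ω : Type*} [MeasurableSpace Ω] {μ : Measure Ω} [IsProbabilityMeasure μ]
    {x y z r : Ω → ℝ} {k l e c c' : ℝ} (hx : Integrable x μ) (hy : Integrable y μ)
    (hz : Integrable z μ) (hr : Integrable r μ) :
    ∫ ω, (x ω + y ω - k * (x ω + y ω) - l * z ω + e + c * (c' * r ω)) ∂μ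
      = ∫ ω, x ω ∂μ + ∫ ω, y ω ∂μ - k * (∫ ω, x ω ∂μ + ∫ ω, y ω ∂μ) - l * ∫ ω, z ω ∂μ + e
        + c * (c' * ∫ ω, r ω ∂μ) := by
  have h1 : Integrable (fun ω => x ω + y ω) μ := hx.add hy
  have h2 : Integrable (fun ω => x ω + y ω - k * (x ω + y ω)) μ := h1.sub (h1.const_mul k)
  have h3 : Integrable (fun ω => x ω + y ω - k * (x ω + y ω) - l * z ω) μ :=
    h2.sub (hz.const_mul l)
  have h4 : Integrable (fun ω => x ω + y ω - k * (x ω + y ω) - l * z ω + e) μ :=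
    h3.add (integrable_const e)
  rw [integral_add h4 ((hr.const_mul c').const_mul c), integral_add h3 (integrable_const e),
    integral_sub h2 (hz.const_mul l), integral_sub h1 (h1.const_mul k), integral_const_mul,
    integral_const_mul, integral_const_mul, integral_const_mul, integral_add hx hy, integral_const,
    probReal_univ, one_smul]

lemma integral_change {Ω : Type*} [MeasurableSpace Ω] {μ : Measure Ω} {D x' y' x y : Ω → ℝ}
    (hD : Integrable D μ) (hx' : Integrable x' μ) (hy' : Integrable y' μ) (hx : Integrable x μ)
    (hy : Integrable y μ) :
    ∫ ω, (D ω + ((x' ω + y' ω) - (x ω + y ω))) ∂μ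
      = ∫ ω, D ω ∂μ + ∫ ω, (x' ω + y' ω) ∂μ - (∫ ω, x ω ∂μ + ∫ ω, y ω ∂μ) := by
  have h1 : Integrable (fun ω => x ω + y ω) μ := hx.add hy
  have h1' : Integrable (fun ω => x' ω + y' ω) μ := hx'.add hy'
  have h2 : Integrable (fun ω => (x' ω + y' ω) - (x ω + y ω)) μ := h1'.sub h1
  rw [integral_add hD h2, integral_sub h1' h1, integral_add hx hy]
  ring

/-- The sum of the squared distances of all models to `w`. -/
def State.sqDist (w : Vec d) (x : State d M) : ℝ := (∑ m, ‖x.loc m - w‖ ^ 2) + ‖x.glob - w‖ ^ 2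

variable (S B T) in
/-- The increase of the mean squared distance that one node can cause in step `t + 1`. -/
def updateError (t : ℕ) : ℝ :=
  -- In order: the squared gradients with the price of averaging, the sampling bias, and the
  -- Gaussian noise.
  20 * B ^ 2 / (S.a ^ 2 * S.γ ^ 2 * ((t : ℝ) + 1) ^ 2)
    + 8 * B ^ 2 / (S.a ^ 2 * S.γ ^ 2 * ((t : ℝ) + 1) * (S.b * ((T : ℝ) - t)))
    + 2 * d * (8 * S.L ^ 2 * Real.log (1.25 / S.δ) /
        (S.a ^ 2 * S.γ ^ 2 * (S.b : ℝ) ^ 2 * S.ε ^ 2) * (258 / ((t : ℝ) + 1) ^ 2))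

namespace Regular

variable (hS : S.Regular B T) (hp : S.IsController p)
include hS hp

lemma integrable_sqDist {wStar : Vec d} (hw : wStar ∈ S.W) (t k : ℕ) (hk : k ≤ M) :
    Integrable (fun ω => (S.stage p ω t k).sqDist wStar) (law d n M ν) :=
  (integrable_finsetSum _ fun m _ => hS.integrable_loc hp hw t k hk m).add
    (hS.integrable_glob hp hw t k hk)

variable (hpa : ∀ t m ω, 1 ≤ t → t ≤ T → S.a ≤ p t m ω ∧ S.a ≤ 1 - p t m ω)
  {wStar : Vec d} (hw : wStar ∈ S.W)
  (hmin : ∀ w ∈ S.W, empiricalRisk S.f wStar ≤ empiricalRisk S.f w)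
include hpa hw hmin

/-- Only the acting node's model and the global model change. The bias takes half of the local
contraction, and half of the global one is discarded to match. Since the node has not acted before
in this step, its local term can be read off at the beginning of the step. -/
lemma integral_sqDist_update_le {t : ℕ} (ht : t + 1 ≤ T) (hat : 1 ≤ S.a ^ 2 * ((t : ℝ) + 1))
    (j : Fin M) :
    ∫ ω, (S.stage p ω t (j + 1)).sqDist wStar ∂(law d n M ν)
      ≤ ∫ ω, (S.stage p ω t j).sqDist wStar ∂(law d n M ν)
        - 2 / ((t : ℝ) + 1) *
          (∫ ω, ‖(S.run p ω t).loc (S.order (t + 1) j) - wStar‖ ^ 2 ∂(law d n M ν)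
            + ∫ ω, ‖(S.stage p ω t j).glob - wStar‖ ^ 2 ∂(law d n M ν))
        + S.updateError B T t := by
  have hprob := isProbabilityMeasure_law (d := d) ν hS.dvd
  have hupd := hS.integral_update_le hp (ν := ν) hpa hw ht j
  have hbias := hS.neg_integral_inner_batchGrad_le (ν := ν) hp hw hmin ht j
  have hnoise := hS.integral_inv_last_le (ν := ν) hp hpa ht hat (S.order (t + 1) j)
  have e1 : ∀ ω, (S.stage p ω t j).loc (S.order (t + 1) j)
      = (S.run p ω t).loc (S.order (t + 1) j) := fun ω =>
    (stage_eq_of_le ω t (Nat.zero_le _) j.2.le j (Or.inr le_rfl)).1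
  have e2 : ∀ ω, (S.stage p ω t j).last (S.order (t + 1) j)
      = (S.run p ω t).last (S.order (t + 1) j) := fun ω =>
    (stage_eq_of_le ω t (Nat.zero_le _) j.2.le j (Or.inr le_rfl)).2
  have i1 := hS.integrable_loc hp hw (ν := ν) t j j.2.le (S.order (t + 1) j)
  have i2 := hS.integrable_glob hp hw (ν := ν) t j j.2.le
  have i3 := hS.integrable_inner_batchGrad hp (ν := ν) hw ht j j.2.le (S.order (t + 1) j)
  have i4 := hS.integrable_last hp (ν := ν) t j j.2.le (S.order (t + 1) j)
  have i1' := hS.integrable_loc hp hw (ν := ν) t (j + 1) j.2 (S.order (t + 1) j)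
  have i2' := hS.integrable_glob hp hw (ν := ν) t (j + 1) j.2
  have hdiff : ∀ ω, (S.stage p ω t (j + 1)).sqDist wStar
      = (S.stage p ω t j).sqDist wStar
        + ((‖(S.stage p ω t (j + 1)).loc (S.order (t + 1) j) - wStar‖ ^ 2
            + ‖(S.stage p ω t (j + 1)).glob - wStar‖ ^ 2)
          - (‖(S.stage p ω t j).loc (S.order (t + 1) j) - wStar‖ ^ 2
            + ‖(S.stage p ω t j).glob - wStar‖ ^ 2)) := by
    intro ω
    unfold State.sqDist
    rw [← Finset.add_sum_erase _ _ (Finset.mem_univ (S.order (t + 1) j)),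
      ← Finset.add_sum_erase _ (fun m => ‖(S.stage p ω t j).loc m - wStar‖ ^ 2)
        (Finset.mem_univ (S.order (t + 1) j)),
      Finset.sum_congr rfl fun m hm => by
        rw [stage_succ, (nodeUpdate_of_ne (Finset.ne_of_mem_erase hm)).1]]
    ring
  have iD := hS.integrable_sqDist hp hw (ν := ν) t j j.2.le
  simp_rw [hdiff]
  rw [integral_change iD i1' i2' i1 i2]
  rw [integral_bound_eq i1 i2 i3 i4] at hupd
  have hη : S.stepSize (t + 1) ^ 2 = 1 / (S.a ^ 2 * S.γ ^ 2 * ((t : ℝ) + 1) ^ 2) := by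
    rw [stepSize, div_pow, mul_pow, mul_pow]; push_cast; ring
  have hc : (0 : ℝ) ≤ 8 * S.L ^ 2 * Real.log (1.25 / S.δ) /
      (S.a ^ 2 * S.γ ^ 2 * (S.b : ℝ) ^ 2 * S.ε ^ 2) := by
    have := hS.log_pos
    positivity
  set c := 8 * S.L ^ 2 * Real.log (1.25 / S.δ) /
      (S.a ^ 2 * S.γ ^ 2 * (S.b : ℝ) ^ 2 * S.ε ^ 2) with hcdef
  simp_rw [← e1, updateError]
  simp_rw [← e2] at hnoise
  rw [← hcdef]
  have hnoise' := mul_le_mul_of_nonneg_left hnoise (mul_nonneg (by positivity : (0 : ℝ) ≤ 2 * d) hc)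
  have h20 : 20 * S.stepSize (t + 1) ^ 2 * B ^ 2
      = 20 * B ^ 2 / (S.a ^ 2 * S.γ ^ 2 * ((t : ℝ) + 1) ^ 2) := by rw [hη]; ring
  have h4 : 4 / ((t : ℝ) + 1) = 2 * (2 / ((t : ℝ) + 1)) := by ring
  have hnn : 0 ≤ 2 / ((t : ℝ) + 1) * ∫ ω, ‖(S.stage p ω t j).glob - wStar‖ ^ 2 ∂(law d n M ν) :=
    mul_nonneg (by positivity) (integral_nonneg fun ω => by positivity)
  rw [h20, h4] at hupd
  linarith

end Regular

end Setup


/-! ### Summation over nodes and over time -/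

namespace Setup

variable {d n M : ℕ} {S : Setup d n M} {B : ℝ} {T : ℕ} {Ξ : Type} [MeasurableSpace Ξ]
  {ν : Measure Ξ} [IsProbabilityMeasure ν] {p : ℕ → Fin M → Sample d n M Ξ → ℝ}

namespace Regular

variable (hS : S.Regular B T) (hp : S.IsController p)
include hS hp

lemma integral_sqDist_eq {wStar : Vec d} (hw : wStar ∈ S.W) (t : ℕ) :
    ∫ ω, (S.run p ω t).sqDist wStar ∂(law d n M ν)
      = ∑ m, ∫ ω, ‖(S.run p ω t).loc m - wStar‖ ^ 2 ∂(law d n M ν)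
        + ∫ ω, ‖(S.run p ω t).glob - wStar‖ ^ 2 ∂(law d n M ν) := by
  have i1 := fun m => hS.integrable_loc hp hw (ν := ν) t 0 (Nat.zero_le _) m
  have i2 := hS.integrable_glob hp hw (ν := ν) t 0 (Nat.zero_le _)
  simp only [stage] at i1 i2
  unfold State.sqDist
  rw [integral_add (integrable_finsetSum _ fun m _ => i1 m) i2,
    integral_finsetSum _ fun m _ => i1 m]

lemma integral_sqDist_le {wStar : Vec d} (hw : wStar ∈ S.W) (t : ℕ) :
    ∫ ω, (S.run p ω t).sqDist wStar ∂(law d n M ν) ≤ 2 * M * (2 * B / S.γ) ^ 2 := by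
  have hprob := isProbabilityMeasure_law (d := d) ν hS.dvd
  have h := integral_mono (hS.integrable_sqDist hp hw (ν := ν) t 0 (Nat.zero_le _))
    (integrable_const (2 * M * (2 * B / S.γ) ^ 2 : ℝ)) fun ω => by
      have hW := hS.stage_mem (p := p) ω t 0 (Nat.zero_le _)
      have h1 := Finset.sum_le_card_nsmul Finset.univ
        (fun m => ‖(S.stage p ω t 0).loc m - wStar‖ ^ 2) _
        fun m _ => hS.norm_sub_sq_le (hW.1 m) hw
      have h2 := hS.norm_sub_sq_le hW.2 hw
      have hM : (1 : ℝ) ≤ M := by exact_mod_cast hS.M_pos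
      have h3 : (2 * B / S.γ) ^ 2 ≤ M * (2 * B / S.γ) ^ 2 :=
        le_mul_of_one_le_left (by positivity) hM
      rw [Finset.card_univ, Fintype.card_fin, nsmul_eq_mul] at h1
      simp only [State.sqDist]
      linarith
  rwa [integral_const, probReal_univ, one_smul] at h

variable (hpa : ∀ t m ω, 1 ≤ t → t ≤ T → S.a ≤ p t m ω ∧ S.a ≤ 1 - p t m ω)
  {wStar : Vec d} (hw : wStar ∈ S.W)
  (hmin : ∀ w ∈ S.W, empiricalRisk S.f wStar ≤ empiricalRisk S.f w)
include hpa hw hmin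

/-- Every node acts once from its model at the beginning of the step, so the local decreases add up
to the whole local sum. Only the first acting node sees the initial global model of the step; its
global decrease suffices and the later ones are dropped. -/
lemma integral_sqDist_step_le {t : ℕ} (ht : t + 1 ≤ T) (hat : 1 ≤ S.a ^ 2 * ((t : ℝ) + 1)) :
    ∫ ω, (S.run p ω (t + 1)).sqDist wStar ∂(law d n M ν)
      ≤ (1 - 2 / ((t : ℝ) + 1)) * ∫ ω, (S.run p ω t).sqDist wStar ∂(law d n M ν)
        + M * S.updateError B T t := by
  set x : ℕ → ℝ := fun k => if h : k < M then
    ∫ ω, ‖(S.run p ω t).loc (S.order (t + 1) ⟨k, h⟩) - wStar‖ ^ 2 ∂(law d n M ν) else 0 with hx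
  set y := ∫ ω, ‖(S.run p ω t).glob - wStar‖ ^ 2 ∂(law d n M ν) with hy
  -- Stated from the first update on, since that update supplies the global term `y`.
  have key : ∀ k, k + 1 ≤ M → ∫ ω, (S.stage p ω t (k + 1)).sqDist wStar ∂(law d n M ν)
      ≤ ∫ ω, (S.run p ω t).sqDist wStar ∂(law d n M ν)
        - 2 / ((t : ℝ) + 1) * (∑ i ∈ Finset.range (k + 1), x i + y)
        + ((k : ℝ) + 1) * S.updateError B T t := by
    intro k
    induction k with
    | zero =>
      intro hk
      have h := hS.integral_sqDist_update_le hp (ν := ν) hpa hw hmin ht hat ⟨0, hk⟩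
      rw [Finset.sum_range_one, hx]
      simp only [dif_pos (show 0 < M from hk)]
      simp only [Nat.cast_zero, zero_add, one_mul]
      exact h
    | succ k ih =>
      intro hk
      have h := hS.integral_sqDist_update_le hp (ν := ν) hpa hw hmin ht hat ⟨k + 1, hk⟩
      have ih := ih (by omega)
      have hxk : x (k + 1) = ∫ ω, ‖(S.run p ω t).loc (S.order (t + 1) ⟨k + 1, hk⟩) - wStar‖ ^ 2
        ∂(law d n M ν) := dif_pos hk
      rw [Finset.sum_range_succ, hxk]
      have hnn : 0 ≤ 2 / ((t : ℝ) + 1) *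
          ∫ ω, ‖(S.stage p ω t (k + 1)).glob - wStar‖ ^ 2 ∂(law d n M ν) :=
        mul_nonneg (by positivity) (integral_nonneg fun ω => by positivity)
      simp only at h
      push_cast
      linarith
  have hM := hS.M_pos
  have h := key (M - 1) (by omega)
  have hM1 : ((M - 1 : ℕ) : ℝ) + 1 = M := by
    rw [← Nat.cast_add_one]; congr 1; omega
  rw [hM1, Nat.sub_add_cancel hM] at h
  have hsum : ∑ i ∈ Finset.range M, x i
      = ∑ m, ∫ ω, ‖(S.run p ω t).loc m - wStar‖ ^ 2 ∂(law d n M ν) := by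
    rw [Finset.sum_range, ← Equiv.sum_comp (S.order (t + 1))
      fun m => ∫ ω, ‖(S.run p ω t).loc m - wStar‖ ^ 2 ∂(law d n M ν)]
    exact Finset.sum_congr rfl fun i _ => dif_pos i.2
  rw [hsum, hy, ← hS.integral_sqDist_eq hp hw] at h
  simp_rw [run_succ]
  linarith

/-- The weight t² telescopes because (t + 1)²(1 - 2/(t + 1)) = t² - 1. The coefficient 28 = 20 + 8
covers both the recursive error and the early steps. -/
lemma sq_mul_integral_sqDist_le {t : ℕ} (ht : t ≤ T) :
    (t : ℝ) ^ 2 * ∫ ω, (S.run p ω t).sqDist wStar ∂(law d n M ν)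
      ≤ M / (S.a ^ 2 * S.γ ^ 2) * ((28 * B ^ 2
          + 4128 * d * (S.L ^ 2 * Real.log (1.25 / S.δ) / ((S.b : ℝ) ^ 2 * S.ε ^ 2))) * t
        + 8 * B ^ 2 / S.b * ∑ s ∈ Finset.range t, ((s : ℝ) + 1) / ((T : ℝ) - s)) := by
  have ha := hS.a_pos
  have hγ := hS.γ_pos
  have hε := hS.ε_pos
  have hlog := hS.log_pos
  have hb : (0 : ℝ) < S.b := by exact_mod_cast hS.b_pos
  set N := 4128 * d * (S.L ^ 2 * Real.log (1.25 / S.δ) / ((S.b : ℝ) ^ 2 * S.ε ^ 2)) with hN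
  have hN0 : 0 ≤ N := by positivity
  induction t with
  | zero => simp
  | succ t ih =>
    have ih := ih (by omega)
    set I := ∫ ω, (S.run p ω (t + 1)).sqDist wStar ∂(law d n M ν) with hI
    have hTt : ∀ s ∈ Finset.range (t + 1), (0 : ℝ) < (T : ℝ) - s := fun s hs => by
      rw [sub_pos]; exact_mod_cast (Finset.mem_range.1 hs).trans_le ht
    have hsum0 : 0 ≤ ∑ s ∈ Finset.range (t + 1), ((s : ℝ) + 1) / ((T : ℝ) - s) :=
      Finset.sum_nonneg fun s hs => div_nonneg (by positivity) (hTt s hs).le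
    push_cast
    rcases le_or_gt 1 (S.a ^ 2 * ((t : ℝ) + 1)) with hat | hat
    · have hstep := hS.integral_sqDist_step_le hp (ν := ν) hpa hw hmin ht hat
      have hD : 0 ≤ ∫ ω, (S.run p ω t).sqDist wStar ∂(law d n M ν) :=
        integral_nonneg fun ω => by unfold State.sqDist; positivity
      set D := ∫ ω, (S.run p ω t).sqDist wStar ∂(law d n M ν)
      have h1 := mul_le_mul_of_nonneg_left hstep (by positivity : 0 ≤ ((t : ℝ) + 1) ^ 2)
      have e1 : ((t : ℝ) + 1) ^ 2 * ((1 - 2 / ((t : ℝ) + 1)) * D) = (t : ℝ) ^ 2 * D - D := by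
        field_simp
        ring
      have hT := hTt t (by simp)
      have e2 : ((t : ℝ) + 1) ^ 2 * (M * S.updateError B T t)
          = M / (S.a ^ 2 * S.γ ^ 2) *
            (20 * B ^ 2 + N + 8 * B ^ 2 / S.b * (((t : ℝ) + 1) / ((T : ℝ) - t))) := by
        have := hT.ne'
        rw [updateError, hN]
        field_simp
        ring
      rw [mul_add, e1, e2] at h1
      rw [Finset.sum_range_succ]
      have h3 : 0 ≤ M / (S.a ^ 2 * S.γ ^ 2) * (8 * B ^ 2) := by positivity
      linarith
    -- Early steps, a²(t + 1) < 1: the diameter bound carries one factor t + 1 too many, and that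
    -- factor is below 1/a².
    · have hle := hS.integral_sqDist_le hp (ν := ν) hw (t + 1)
      rw [← hI] at hle
      have h1 := mul_le_mul_of_nonneg_left hle (by positivity : 0 ≤ ((t : ℝ) + 1) ^ 2)
      refine h1.trans ?_
      have h2 : ((t : ℝ) + 1) ≤ 1 / S.a ^ 2 := by
        rw [le_div_iff₀ (by positivity)]; linarith
      calc ((t : ℝ) + 1) ^ 2 * (2 * M * (2 * B / S.γ) ^ 2)
          = ((t : ℝ) + 1) * (8 * M * B ^ 2 / S.γ ^ 2 * ((t : ℝ) + 1)) := by ring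
        _ ≤ (1 / S.a ^ 2) * (8 * M * B ^ 2 / S.γ ^ 2 * ((t : ℝ) + 1)) := by gcongr
        _ = M / (S.a ^ 2 * S.γ ^ 2) * (8 * B ^ 2 * ((t : ℝ) + 1)) := by field_simp
        _ ≤ _ := by
          have h3 : 0 ≤ 20 * B ^ 2 * ((t : ℝ) + 1) := by positivity
          have h4 : 0 ≤ N * ((t : ℝ) + 1) := by positivity
          have h5 := mul_nonneg (by positivity : 0 ≤ 8 * B ^ 2 / S.b) hsum0
          gcongr
          linarith

lemma integral_sqDist_final {t : ℕ} (h1t : 1 ≤ t) (ht : t ≤ T) :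
    ∫ ω, (S.run p ω t).sqDist wStar ∂(law d n M ν)
      ≤ 4128 / S.γ ^ 2 * (M * B ^ 2 / (S.a ^ 2 * t)
        + M * B ^ 2 * Real.log t / (S.a ^ 2 * S.b * t)
        + d * (M * S.L ^ 2 * Real.log (1.25 / S.δ) /
          (S.a ^ 2 * (S.b : ℝ) ^ 2 * S.ε ^ 2 * t))) := by
  have h := hS.sq_mul_integral_sqDist_le hp (ν := ν) hpa hw hmin ht
  have hsum := sum_div_le ht h1t
  have ha := hS.a_pos
  have hγ := hS.γ_pos
  have hε := hS.ε_pos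
  have hlog := hS.log_pos
  have hb : (1 : ℝ) ≤ S.b := by exact_mod_cast hS.b_pos
  have ht0 : (0 : ℝ) < t := by exact_mod_cast h1t
  have hlt : 0 ≤ Real.log t := Real.log_natCast_nonneg t
  refine le_of_mul_le_mul_left (h.trans ?_) (by positivity : (0 : ℝ) < (t : ℝ) ^ 2)
  calc _ ≤ M / (S.a ^ 2 * S.γ ^ 2) * ((28 * B ^ 2
          + 4128 * d * (S.L ^ 2 * Real.log (1.25 / S.δ) / ((S.b : ℝ) ^ 2 * S.ε ^ 2))) * t
        + 8 * B ^ 2 / S.b * (t * (1 + Real.log t))) := by gcongr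
    _ = M / (S.a ^ 2 * S.γ ^ 2) * t * (28 * B ^ 2 + 8 * B ^ 2 / S.b + 8 * (B ^ 2 * Real.log t / S.b)
          + 4128 * d * (S.L ^ 2 * Real.log (1.25 / S.δ) / ((S.b : ℝ) ^ 2 * S.ε ^ 2))) := by ring
    -- The constant 4128 = 2 · 8 · 258 comes from the noise term and dominates the other
    -- coefficients.
    _ ≤ M / (S.a ^ 2 * S.γ ^ 2) * t * (4128 * B ^ 2 + 4128 * (B ^ 2 * Real.log t / S.b)
          + 4128 * d * (S.L ^ 2 * Real.log (1.25 / S.δ) / ((S.b : ℝ) ^ 2 * S.ε ^ 2))) := by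
      have h1 : 8 * B ^ 2 / S.b ≤ 8 * B ^ 2 := div_le_self (by positivity) hb
      have h2 : 0 ≤ B ^ 2 * Real.log t / S.b := by positivity
      gcongr
      · nlinarith [sq_nonneg B]
      · norm_num
    _ = _ := by field_simp

end Regular

end Setup

end DeepQSGD
end

/-! ### The main theorem -/

theorem theorem7 (γ : ℝ) (hγ : 0 < γ) :
    ∃ C : ℝ, 0 < C ∧
      ∀ (d n M : ℕ) (S : DeepQSGD.Setup d n M) (B : ℝ) (T : ℕ) (wStar : DeepQSGD.Vec d)
        (Ξ : Type) [MeasurableSpace Ξ] (ν : MeasureTheory.Measure Ξ)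
        [MeasureTheory.IsProbabilityMeasure ν]
        (p : ℕ → Fin M → DeepQSGD.Sample d n M Ξ → ℝ),
        0 < M → M ∣ n → 0 < S.b → 1 ≤ T → (T : ℝ) ≤ (n : ℝ) / ((S.b : ℝ) * (M : ℝ)) →
        IsClosed S.W → Convex ℝ S.W →
        (∀ m, S.initLocal m ∈ S.W) → S.initGlobal ∈ S.W →
        S.γ = γ → 0 ≤ S.L → 0 < B → 0 < S.ε → 0 < S.δ → S.δ < 1 →
        (∀ i, DeepQSGD.StronglyConvex S.W γ (S.f i)) →
        (∀ i, DeepQSGD.Lipschitz S.W S.L (S.f i)) →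
        (∀ i, ∀ w ∈ S.W, ‖gradient (S.f i) w‖ ^ 2 ≤ B ^ 2) →
        wStar ∈ S.W →
        (∀ w ∈ S.W, DeepQSGD.empiricalRisk S.f wStar ≤ DeepQSGD.empiricalRisk S.f w) →
        S.IsController p →
        0 < S.a → (∀ t m ω, 1 ≤ t → t ≤ T → S.a ≤ p t m ω ∧ S.a ≤ 1 - p t m ω) →
        ∀ t : ℕ, 1 ≤ t → t ≤ T →
          (∀ m, MeasureTheory.Integrable (fun ω => ‖(S.run p ω t).loc m - wStar‖ ^ 2)
            (DeepQSGD.law d n M ν)) ∧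
          MeasureTheory.Integrable (fun ω => ‖(S.run p ω t).glob - wStar‖ ^ 2)
            (DeepQSGD.law d n M ν) ∧
          (∑ m, ∫ ω, ‖(S.run p ω t).loc m - wStar‖ ^ 2 ∂(DeepQSGD.law d n M ν)) +
              (∫ ω, ‖(S.run p ω t).glob - wStar‖ ^ 2 ∂(DeepQSGD.law d n M ν)) ≤
            C * (M * B ^ 2 / (S.a ^ 2 * t) +
              M * B ^ 2 * Real.log t / (S.a ^ 2 * S.b * t) +
              d * (M * S.L ^ 2 * Real.log (1.25 / S.δ) /
                (S.a ^ 2 * (S.b : ℝ) ^ 2 * S.ε ^ 2 * t))) := by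
  refine ⟨4128 / γ ^ 2, by positivity, ?_⟩
  intro d n M S B T wStar Ξ _ ν _ p hM hd hb h1T hT hc hconv hil hig hSγ hL hB hε hδ hδ1 hsc _ hgrad
    hw hmin hp ha hpa t h1t ht
  subst hSγ
  have hTn : T * (S.b * M) ≤ n := by
    have h : (0 : ℝ) < (S.b : ℝ) * (M : ℝ) := by positivity
    rw [le_div_iff₀ h] at hT
    exact_mod_cast hT
  have hn : 0 < n := lt_of_lt_of_le (by positivity) hTn
  have hS : S.Regular B T :=
    { n_pos := hn
      M_pos := hM
      dvd := hd
      b_pos := hb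
      T_mul_le := (Nat.le_div_iff_mul_le hM).2 (by rwa [mul_assoc])
      isClosed := hc
      convex := hconv
      initLocal_mem := hil
      initGlobal_mem := hig
      γ_pos := hγ
      a_pos := ha
      L_nonneg := hL
      ε_pos := hε
      δ_pos := hδ
      δ_lt_one := hδ1
      stronglyConvex := hsc
      norm_gradient_le := fun i w hwW =>
        (abs_le_of_sq_le_sq' (hgrad i w hwW) hB.le).2 }
  refine ⟨fun m => hS.integrable_loc hp hw t 0 (Nat.zero_le _) m,
    hS.integrable_glob hp hw t 0 (Nat.zero_le _), ?_⟩
  rw [← hS.integral_sqDist_eq hp hw]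
  exact hS.integral_sqDist_final hp hpa hw hmin h1t ht
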